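/- Let $T>0$ and $p\in(1,\infty)$. Let $\phi\in L^1([0,T]^2;\mathbb R)$ be symmetric and positive definite (i.e. $\int_0^T\!\int_0^T f(u)f(v)\phi(u,v)\,du\,dv\ge 0$ for all $f\in L^p([0,T];\mathbb R)$), and suppose that there is $C\in(0,\infty)$ with $$\int_0^T\!\!\int_0^T |f(u)f(v)\phi(u,v)|\,du\,dv\le C\|f\|_{L^p([0,T];\mathbb R)}^2\quad\text{for all } f\in L^p([0,T];\mathbb R).$$ Let $g_n=(g_n(t))_{t\in[0,T]}$, $n\in\mathbb N$, be independent centred real Gaussian processes on a probability space $(\Omega,\mathcal F,P)$, each with covariance function $R(t,s)=\int_0^s\int_0^t\phi(u,v)\,du\,dv$. Let $\mathcal H$ and $U$ be separable real Hilbert spaces, $(e_n)_{n\in\mathbb N}$ an orthonormal basis of $U$, and $\lambda_n>0$ with $\sum_n\sqrt{\lambda_n}<\infty$; put $Qz:=\sum_n\lambda_n\langle z,e_n\rangle_U e_n$ for $z\in U$. Let $L(U,\mathcal H)$ be the space of bounded linear operators with the operator norm. For each $n$ there is exactly one continuous linear map $f\mapsto\int_0^T f\,dg_n$ from $L^p([0,T];\mathcal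 H)$ to $L^2(\Omega;\mathcal H)$ that sends $1_{(s,t]}x$ to $(g_n(t)-g_n(s))x$ for all $0\le s\le t\le T$ and $x\in\mathcal H$. Put $\int_0^t f\,dg_n:=\int_0^T 1_{(0,t]}f\,dg_n$. For $h\in L^p([0,T];L(U,\mathcal H))$ and $t\in[0,T]$ the series $$\int_0^t h(s)\,dG(s):=\sum_{n}\sqrt{\lambda_n}\int_0^t h(s)e_n\,dg_n(s)$$ converges in $L^2(\Omega;\mathcal H)$. Moreover: (i) For every $h\in L^p([0,T];L(U,\mathcal H))$, $\big(\int_0^t h\,dG\big)_{t\in[0,T]}$ is an $\mathcal H$-valued Gaussian process. (ii) If $h\in L^{p+\varepsilon}([0,T];L(U,\mathcal H))$ for some $\varepsilon>0$, then this process has a modification with continuous sample paths in $\mathcal H$. (iii) For all $h_1,h_2\in L^p([0,T];L(U,\mathcal H))$ and $x,y\in\mathcal H$, $$E\Big(\Big\langle\int_0^T h_1\,dG,x\Big\rangle_{\mathcal H}\Big\langle\int_0^T h_2\,dG,y\Big\rangle_{\mathcal H}\Big)=\int_0^T\!\!\int_0^T\langle h_2(s')Qh_1(s)^*x,y\rangle_{\mathcal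 H}\,\phi(s,s')\,ds\,ds'.$$ (iv) For all $h_1,h_2\in L^p([0,T];L(U,\mathcal H))$, the operators $h_2(s')Qh_1(s)^*$ are of trace class and $$E\Big\langle\int_0^T h_1\,dG,\int_0^T h_2\,dG\Big\rangle_{\mathcal H}=\int_0^T\!\!\int_0^T\mathrm{Tr}\big(h_2(s')Qh_1(s)^*\big)\,\phi(s,s')\,ds\,ds'.$$ The integrands on the right-hand sides of (iii) and (iv) are integrable on $[0,T]^2$. -/

import Mathlib

open MeasureTheory ProbabilityTheory Set
open scoped ENNReal NNReal RealInnerProductSpace InnerProduct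

noncomputable section

namespace GaussianIntegral

/-- Lebesgue measure `ds` on the time interval `[0, T]`. -/
abbrev timeMeasure (T : ℝ) : Measure ℝ := volume.restrict (Icc 0 T)

/-- The condition on the kernel `φ` (for the exponent `p`): it is integrable on `[0,T]²`, symmetric,
positive definite (as an integral kernel, hence tested against functions in `L^p`), and there is
`C ∈ (0, ∞)` with `∫∫ |f(u) f(v) φ(u,v)| du dv ≤ C ‖f‖²_{L^p}` for all real `f ∈ L^p([0,T])`. -/
structure KernelCondition (T : ℝ) (φ : ℝ → ℝ → ℝ) (p : ℝ≥0∞) : Prop where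
  integrable : Integrable (fun z : ℝ × ℝ => φ z.1 z.2) ((timeMeasure T).prod (timeMeasure T))
  symm : ∀ᵐ z : ℝ × ℝ ∂((timeMeasure T).prod (timeMeasure T)), φ z.1 z.2 = φ z.2 z.1
  posDef : ∀ f : ℝ → ℝ, MemLp f p (timeMeasure T) →
    0 ≤ ∫ v in (0 : ℝ)..T, ∫ u in (0 : ℝ)..T, f u * f v * φ u v
  bound : ∃ C : ℝ≥0, 0 < C ∧ ∀ f : ℝ → ℝ, MemLp f p (timeMeasure T) →
    ∫⁻ v in Icc 0 T, ∫⁻ u in Icc 0 T, ‖f u * f v * φ u v‖ₑ ≤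
      C * eLpNorm f p (timeMeasure T) ^ 2

/-- The covariance function `R(t,s) = ∫_0^s ∫_0^t φ(u,v) du dv`. -/
def kernelCov (φ : ℝ → ℝ → ℝ) (t s : ℝ) : ℝ :=
  ∫ v in (0 : ℝ)..s, ∫ u in (0 : ℝ)..t, φ u v

section Wiener

variable {Ω : Type*} [MeasurableSpace Ω] (P : Measure Ω)
  {H : Type*} [NormedAddCommGroup H] [InnerProductSpace ℝ H]
  {T : ℝ} (p : ℝ≥0∞) [Fact (1 ≤ p)] (g : Icc (0 : ℝ) T → Ω → ℝ)

/-- `I : L^p([0,T]; H) → L²(Ω; H)` is the integral operator `f ↦ ∫_0^T f dg`: it is linear and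
continuous, and sends the step function `1_{(s,t]} x` to `(g(t) - g(s)) x`. As step functions are
dense in `L^p([0,T]; H)` for `p < ∞`, there is at most one such operator. -/
def IsWienerIntegral (I : Lp H p (timeMeasure T) →L[ℝ] Lp H 2 P) : Prop :=
  ∀ s t : Icc (0 : ℝ) T, s ≤ t → ∀ x : H,
    I (indicatorConstLp p (measurableSet_Ioc : MeasurableSet (Ioc (s : ℝ) t))
      (measure_ne_top (timeMeasure T) _) x) =ᵐ[P] fun ω => (g t ω - g s ω) • x

open Classical in
/-- The integral operator `f ↦ ∫_0^T f dg` from `L^p([0,T]; H)` to `L²(Ω; H)`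
(zero if there is none). -/
def wienerIntegralL : Lp H p (timeMeasure T) →L[ℝ] Lp H 2 P :=
  if h : ∃ I : Lp H p (timeMeasure T) →L[ℝ] Lp H 2 P, IsWienerIntegral P p g I
  then h.choose else 0

open Classical in
/-- `∫_0^t f dg := ∫_0^T 1_{(0,t]} f dg ∈ L²(Ω; H)` for `f ∈ L^p([0,T]; H)`
(zero for other `f`). -/
def wienerIntegral (f : ℝ → H) (t : ℝ) : Lp H 2 P :=
  if h : MemLp ((Ioc 0 t).indicator f) p (timeMeasure T)
  then wienerIntegralL P p g h.toLp else 0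

end Wiener

section Series

variable {Ω : Type*} [MeasurableSpace Ω] (P : Measure Ω)
  {U : Type*} [NormedAddCommGroup U] [InnerProductSpace ℝ U]
  {H : Type*} [NormedAddCommGroup H] [InnerProductSpace ℝ H]
  {T : ℝ} (p : ℝ≥0∞) [Fact (1 ≤ p)] (g : ℕ → Icc (0 : ℝ) T → Ω → ℝ)
  (e : HilbertBasis ℕ ℝ U) (lam : ℕ → ℝ)

/-- The `n`-th term `√λ_n ∫_0^t h(s) e_n dg_n(s)`. -/
def gaussianTerm (h : ℝ → U →L[ℝ] H) (t : ℝ) (n : ℕ) : Lp H 2 P :=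
  √(lam n) • wienerIntegral P p (g n) (fun s => h s (e n)) t

/-- `∫_0^t h dG = ∑_n √λ_n ∫_0^t h(s) e_n dg_n(s)`, a series in `L²(Ω; H)`. -/
def gaussianIntegral (h : ℝ → U →L[ℝ] H) (t : ℝ) : Lp H 2 P :=
  ∑' n, gaussianTerm P p g e lam h t n

/-- The operator `Q = ∑_n λ_n ⟨·, e_n⟩ e_n` on `U`. -/
def covOp : U →L[ℝ] U := ∑' n, lam n • InnerProductSpace.rankOne ℝ (e n) (e n)

end Series

/-- The series that defines `Q` converges when `∑ |λ_n| < ∞`, and so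
`Q z = ∑_n λ_n ⟨z, e_n⟩ e_n`. -/
theorem hasSum_covOp {U : Type*} [NormedAddCommGroup U] [InnerProductSpace ℝ U] [CompleteSpace U]
    (e : HilbertBasis ℕ ℝ U) (lam : ℕ → ℝ) (hlam : Summable fun n => |lam n|) (z : U) :
    HasSum (fun n => (lam n * ⟪z, e n⟫) • e n) (covOp e lam z) := by
  have hs : Summable fun n => lam n • InnerProductSpace.rankOne ℝ (e n) (e n) := by
    refine Summable.of_norm (hlam.congr fun n => ?_)
    rw [norm_smul, InnerProductSpace.norm_rankOne, e.orthonormal.1 n]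
    simp
  have h : HasSum _ (covOp e lam z) := hs.hasSum.mapL (ContinuousLinearMap.apply ℝ U z)
  convert h using 2 with n
  simp [InnerProductSpace.rankOne_apply, real_inner_comm, mul_smul]

section Trace

variable {H : Type*} [NormedAddCommGroup H] [InnerProductSpace ℝ H]

/-- Trace-class (nuclear) operators on a Hilbert space: `A z = ∑_n ⟨a_n, z⟩ b_n` with
`∑_n ‖a_n‖ ‖b_n‖ < ∞`. -/
def IsTraceClass (A : H →L[ℝ] H) : Prop :=
  ∃ a b : ℕ → H, (Summable fun n => ‖a n‖ * ‖b n‖) ∧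
    ∀ z, HasSum (fun n => ⟪a n, z⟫ • b n) (A z)

/-- The trace `Tr A = ∑_i ⟨A b_i, b_i⟩` computed in the orthonormal basis `b`. For trace-class
`A` it does not depend on `b`. -/
def trace {ι : Type*} (b : HilbertBasis ι ℝ H) (A : H →L[ℝ] H) : ℝ :=
  ∑' i, ⟪A (b i), b i⟫

end Trace

end GaussianIntegral

end

/-!
A kernel that is absolutely integrable against `f ⊗ f` for all `f ∈ L^p` defines a bounded bilinear
form on `L^p`: homogeneity turns the bound `C (‖f‖ + ‖k‖)²` into `4 C ‖f‖ ‖k‖`. On step functions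
this form is the covariance of the increments of `g n`, so mapping `1_{(0,t]} x` to `g n t • x` is
bounded from the `L^p` norm to the `L²` norm and extends to all of `L^p`. Independence makes the
integrals against different `g n` orthogonal, so second moments of the noise integral are computed
term by term, and `∑ √λ_n < ∞` makes the series converge in operator norm.

All scalar integrals lie in the closed linear span of the variables `g n t`, which consists of
centred Gaussian variables. This gives the Gaussian property. For continuity, Hölder's inequality
makes `t ↦ 1_{(0,t]} h` Hölder continuous in `L^p` when `h ∈ L^{p+ε}`, hence so is the integral in
`L²`. On a closed space of Gaussian variables the `L²` norm controls every `L^q` norm, and the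
Kolmogorov continuity theorem applies for `q` large.
-/

noncomputable section

namespace GaussianIntegral

set_option maxSynthPendingDepth 3

section BoundedKernel

variable {α : Type*} [MeasurableSpace α] {μ : Measure α} {φ : α → α → ℝ} {p : ℝ≥0∞} {C : ℝ≥0}

/-- `φ` is the kernel of an absolutely convergent quadratic form on `L^p(μ)` with bound `C`. -/
structure IsBoundedKernel (μ : Measure α) (φ : α → α → ℝ) (p : ℝ≥0∞) (C : ℝ≥0) : Prop where
  aestronglyMeasurable : AEStronglyMeasurable (fun z : α × α => φ z.1 z.2) (μ.prod μ)
  lintegral_le : ∀ f : α → ℝ, MemLp f p μ →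
    ∫⁻ z : α × α, ‖f z.1 * f z.2 * φ z.1 z.2‖ₑ ∂(μ.prod μ) ≤ C * eLpNorm f p μ ^ 2

theorem KernelCondition.exists_isBoundedKernel {T : ℝ} {φ : ℝ → ℝ → ℝ}
    (hφ : KernelCondition T φ p) : ∃ C, IsBoundedKernel (timeMeasure T) φ p C := by
  obtain ⟨C, -, hC⟩ := hφ.bound
  refine ⟨C, hφ.integrable.1, fun f hf => ?_⟩
  have hmeas : AEMeasurable (fun z : ℝ × ℝ => ‖f z.1 * f z.2 * φ z.1 z.2‖ₑ)
      ((timeMeasure T).prod (timeMeasure T)) :=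
    ((hf.1.comp_fst.mul hf.1.comp_snd).mul hφ.integrable.1).enorm
  rw [lintegral_prod_symm _ hmeas]
  exact hC f hf

section

variable {E F : Type*} [NormedAddCommGroup E] [NormedAddCommGroup F] {f : α → E} {k : α → F}

theorem IsBoundedKernel.lintegral_enorm_mul_le (hφ : IsBoundedKernel μ φ p C) (hp : 1 ≤ p)
    (hf : MemLp f p μ) (hk : MemLp k p μ) :
    ∫⁻ z : α × α, ‖‖f z.1‖ * ‖k z.2‖ * φ z.1 z.2‖ₑ ∂(μ.prod μ) ≤
      C * (eLpNorm f p μ + eLpNorm k p μ) ^ 2 := by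
  set w : α → ℝ := (fun u => ‖f u‖) + fun u => ‖k u‖
  have hfw : ∀ u, ‖f u‖ ≤ w u := fun u => le_add_of_nonneg_right (norm_nonneg _)
  have hkw : ∀ u, ‖k u‖ ≤ w u := fun u => le_add_of_nonneg_left (norm_nonneg _)
  have hmono : ∀ z : α × α,
      ‖‖f z.1‖ * ‖k z.2‖ * φ z.1 z.2‖ₑ ≤ ‖w z.1 * w z.2 * φ z.1 z.2‖ₑ := fun z => by
    refine enorm_le_iff_norm_le.2 ?_
    simp only [norm_mul, norm_norm]
    gcongr
    · exact (hfw _).trans (le_abs_self _)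
    · exact (hkw _).trans (le_abs_self _)
  calc ∫⁻ z : α × α, ‖‖f z.1‖ * ‖k z.2‖ * φ z.1 z.2‖ₑ ∂(μ.prod μ)
      ≤ ∫⁻ z : α × α, ‖w z.1 * w z.2 * φ z.1 z.2‖ₑ ∂(μ.prod μ) := lintegral_mono hmono
    _ ≤ C * eLpNorm w p μ ^ 2 := hφ.lintegral_le w (hf.norm.add hk.norm)
    _ ≤ C * (eLpNorm f p μ + eLpNorm k p μ) ^ 2 := by
      gcongr
      exact (eLpNorm_add_le hf.norm.1 hk.norm.1 hp).trans_eq (by rw [eLpNorm_norm, eLpNorm_norm])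

theorem IsBoundedKernel.integrable_norm_mul (hφ : IsBoundedKernel μ φ p C) (hp : 1 ≤ p)
    (hf : MemLp f p μ) (hk : MemLp k p μ) :
    Integrable (fun z : α × α => ‖f z.1‖ * ‖k z.2‖ * φ z.1 z.2) (μ.prod μ) :=
  ⟨(hf.norm.1.comp_fst.mul hk.norm.1.comp_snd).mul hφ.aestronglyMeasurable,
    (hφ.lintegral_enorm_mul_le hp hf hk).trans_lt <| ENNReal.mul_lt_top ENNReal.coe_lt_top <|
      ENNReal.pow_lt_top (ENNReal.add_lt_top.2 ⟨hf.2, hk.2⟩)⟩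

variable [NormedSpace ℝ E] [NormedSpace ℝ F]

theorem IsBoundedKernel.integrable_apply₂ (hφ : IsBoundedKernel μ φ p C) (hp : 1 ≤ p)
    (B : E →L[ℝ] F →L[ℝ] ℝ) (hf : MemLp f p μ) (hk : MemLp k p μ) :
    Integrable (fun z : α × α => B (f z.1) (k z.2) * φ z.1 z.2) (μ.prod μ) := by
  refine ((hφ.integrable_norm_mul hp hf hk).const_mul ‖B‖).mono
    ((B.aestronglyMeasurable_comp₂ hf.1.comp_fst hk.1.comp_snd).mul hφ.aestronglyMeasurable)
    (ae_of_all _ fun z => ?_)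
  simp only [norm_mul, norm_norm, ← mul_assoc]
  exact mul_le_mul_of_nonneg_right (B.le_opNorm₂ _ _) (norm_nonneg _)

theorem IsBoundedKernel.hasSum_integral_apply₂ (hφ : IsBoundedKernel μ φ p C) (hp : 1 ≤ p)
    {ι : Type*} {b : ι → E →L[ℝ] F →L[ℝ] ℝ} {B : E →L[ℝ] F →L[ℝ] ℝ} (hB : HasSum b B)
    (hf : MemLp f p μ) (hk : MemLp k p μ) :
    HasSum (fun i => ∫ z : α × α, b i (f z.1) (k z.2) * φ z.1 z.2 ∂(μ.prod μ))
      (∫ z : α × α, B (f z.1) (k z.2) * φ z.1 z.2 ∂(μ.prod μ)) := by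
  let J : (E →L[ℝ] F →L[ℝ] ℝ) →ₗ[ℝ] ℝ :=
    { toFun := fun B => ∫ z : α × α, B (f z.1) (k z.2) * φ z.1 z.2 ∂(μ.prod μ)
      map_add' := fun B B' => by
        simp only [_root_.add_apply, add_mul]
        exact integral_add (hφ.integrable_apply₂ hp B hf hk) (hφ.integrable_apply₂ hp B' hf hk)
      map_smul' := fun c B => by
        simp only [_root_.smul_apply, smul_eq_mul, mul_assoc, integral_const_mul,
            RingHom.id_apply] }
  have hJ : ∀ B, ‖J B‖ ≤ (∫ z : α × α, ‖‖f z.1‖ * ‖k z.2‖ * φ z.1 z.2‖ ∂(μ.prod μ)) * ‖B‖ :=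
    fun B => by
      rw [mul_comm, ← integral_const_mul]
      refine norm_integral_le_of_norm_le ((hφ.integrable_norm_mul hp hf hk).norm.const_mul _)
        (ae_of_all _ fun z => ?_)
      simp only [norm_mul, norm_norm, ← mul_assoc]
      exact mul_le_mul_of_nonneg_right (B.le_opNorm₂ _ _) (norm_nonneg _)
  exact hB.mapL (J.mkContinuous _ hJ)

end

variable {H : Type*} [NormedAddCommGroup H] [InnerProductSpace ℝ H]

/-- The form `∫∫ ⟪f u, k v⟫ φ(u, v) μ(du) μ(dv)`, which is the covariance of the integrals of `f`
and `k` against a process with covariance kernel `φ`. -/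
def kernelForm (μ : Measure α) (φ : α → α → ℝ) (f k : α → H) : ℝ :=
  ∫ z : α × α, ⟪f z.1, k z.2⟫ * φ z.1 z.2 ∂(μ.prod μ)

theorem kernelForm_congr {f f' k k' : α → H} (hf : f =ᵐ[μ] f') (hk : k =ᵐ[μ] k') :
    kernelForm μ φ f k = kernelForm μ φ f' k' := by
  refine integral_congr_ae ?_
  filter_upwards [Measure.quasiMeasurePreserving_fst.ae hf,
    Measure.quasiMeasurePreserving_snd.ae hk] with z h1 h2
  rw [h1, h2]

theorem IsBoundedKernel.integrable_inner (hφ : IsBoundedKernel μ φ p C) (hp : 1 ≤ p)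
    {f k : α → H} (hf : MemLp f p μ) (hk : MemLp k p μ) :
    Integrable (fun z : α × α => ⟪f z.1, k z.2⟫ * φ z.1 z.2) (μ.prod μ) :=
  hφ.integrable_apply₂ hp (innerSL ℝ) hf hk

theorem IsBoundedKernel.norm_kernelForm_le (hφ : IsBoundedKernel μ φ p C) (hp : 1 ≤ p)
    (f k : Lp H p μ) : ‖kernelForm μ φ f k‖ ≤ C * (‖f‖ + ‖k‖) ^ 2 := by
  have hf := Lp.memLp f
  have hk := Lp.memLp k
  have hbound : ∫⁻ z : α × α, ‖⟪f z.1, k z.2⟫ * φ z.1 z.2‖ₑ ∂(μ.prod μ) ≤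
      C * (eLpNorm f p μ + eLpNorm k p μ) ^ 2 := by
    refine (lintegral_mono fun z => ?_).trans (hφ.lintegral_enorm_mul_le hp hf hk)
    rw [enorm_mul, enorm_mul (_ * _)]
    gcongr
    exact enorm_le_iff_norm_le.2 (by simpa using norm_inner_le_norm (𝕜 := ℝ) (f z.1) (k z.2))
  have h := (enorm_integral_le_lintegral_enorm _).trans hbound
  have hreal := ENNReal.toReal_mono
    (ENNReal.mul_ne_top ENNReal.coe_ne_top (by finiteness [hf.2.ne, hk.2.ne])) h
  rwa [toReal_enorm, ENNReal.toReal_mul, ENNReal.coe_toReal, ENNReal.toReal_pow,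
    ENNReal.toReal_add hf.2.ne hk.2.ne, ← Lp.norm_def, ← Lp.norm_def] at hreal

/-- The form `kernelForm` as a bilinear map on `L^p(μ; H)`. -/
def IsBoundedKernel.kernelFormₗ (hφ : IsBoundedKernel μ φ p C) (hp : 1 ≤ p) :
    Lp H p μ →ₗ[ℝ] Lp H p μ →ₗ[ℝ] ℝ :=
  have hi (f k : Lp H p μ) := hφ.integrable_inner hp (Lp.memLp f) (Lp.memLp k)
  LinearMap.mk₂ ℝ (fun f k => kernelForm μ φ f k)
    (fun f f' k => by
      rw [kernelForm_congr (Lp.coeFn_add f f') ae_eq_rfl]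
      simp only [kernelForm, Pi.add_apply, inner_add_left, add_mul,
        integral_add (hi f k) (hi f' k)])
    (fun c f k => by
      rw [kernelForm_congr (Lp.coeFn_smul c f) ae_eq_rfl]
      simp only [kernelForm, Pi.smul_apply, real_inner_smul_left, mul_assoc,
        integral_const_mul, smul_eq_mul])
    (fun f k k' => by
      rw [kernelForm_congr ae_eq_rfl (Lp.coeFn_add k k')]
      simp only [kernelForm, Pi.add_apply, inner_add_right, add_mul,
        integral_add (hi f k) (hi f k')])
    (fun c f k => by
      rw [kernelForm_congr ae_eq_rfl (Lp.coeFn_smul c k)]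
      simp only [kernelForm, Pi.smul_apply, real_inner_smul_right, mul_assoc,
        integral_const_mul, smul_eq_mul])

theorem norm_le_four_mul_of_norm_le_add_sq {E F G : Type*} [NormedAddCommGroup E]
    [NormedSpace ℝ E] [NormedAddCommGroup F] [NormedSpace ℝ F] [NormedAddCommGroup G]
    [NormedSpace ℝ G] {B : E →ₗ[ℝ] F →ₗ[ℝ] G} {c : ℝ}
    (h : ∀ x y, ‖B x y‖ ≤ c * (‖x‖ + ‖y‖) ^ 2) (x : E) (y : F) :
    ‖B x y‖ ≤ 4 * c * ‖x‖ * ‖y‖ := by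
  rcases eq_or_ne x 0 with rfl | hx
  · simp
  rcases eq_or_ne y 0 with rfl | hy
  · simp
  have hx' := norm_pos_iff.2 hx
  have hy' := norm_pos_iff.2 hy
  have hunit := h (‖x‖⁻¹ • x) (‖y‖⁻¹ • y)
  simp only [map_smul, LinearMap.smul_apply, norm_smul, norm_inv, norm_norm] at hunit
  rw [inv_mul_cancel₀ hx'.ne', inv_mul_cancel₀ hy'.ne'] at hunit
  field_simp at hunit
  linarith

variable [Fact (1 ≤ p)]

/-- The form `kernelForm` as a bounded bilinear map on `L^p(μ; H)`. -/
def IsBoundedKernel.kernelFormL (hφ : IsBoundedKernel μ φ p C) :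
    Lp H p μ →L[ℝ] Lp H p μ →L[ℝ] ℝ :=
  (hφ.kernelFormₗ Fact.out).mkContinuous₂ (4 * C)
    (norm_le_four_mul_of_norm_le_add_sq (hφ.norm_kernelForm_le Fact.out))

theorem IsBoundedKernel.kernelFormL_apply (hφ : IsBoundedKernel μ φ p C) (f k : Lp H p μ) :
    hφ.kernelFormL f k = kernelForm μ φ f k :=
  rfl

theorem IsBoundedKernel.kernelForm_self_le (hφ : IsBoundedKernel μ φ p C) (f : Lp H p μ) :
    kernelForm μ φ f f ≤ 4 * C * ‖f‖ ^ 2 :=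
  (le_abs_self _).trans <| (norm_le_four_mul_of_norm_le_add_sq
    (B := hφ.kernelFormₗ Fact.out) (hφ.norm_kernelForm_le Fact.out) f f).trans_eq (by ring)

end BoundedKernel

section Density

variable {α : Type*} [m : MeasurableSpace α] {μ : Measure α} [IsFiniteMeasure μ] {p : ℝ≥0∞}
  {E : Type*} [NormedAddCommGroup E]

theorem tendsto_indicatorConstLp_iUnion_of_monotone [Fact (1 ≤ p)] (hp : p ≠ ∞) {s : ℕ → Set α}
    (hs : ∀ n, MeasurableSet (s n)) (hmono : Monotone s) (x : E) :
    Filter.Tendsto (fun n => indicatorConstLp p (hs n) (measure_ne_top μ _) x) Filter.atTop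
      (nhds (indicatorConstLp p (MeasurableSet.iUnion hs) (measure_ne_top μ _) x)) := by
  refine tendsto_indicatorConstLp_set hp ?_
  have hdiff : ∀ n, μ (symmDiff (s n) (⋃ i, s i)) = μ (⋃ i, s i) - μ (s n) := fun n => by
    rw [symmDiff_of_le (subset_iUnion s n)]
    exact measure_sdiff (subset_iUnion s n) (hs n).nullMeasurableSet (measure_ne_top μ _)
  simp only [hdiff]
  simpa using ENNReal.Tendsto.sub (tendsto_const_nhds (x := μ (⋃ i, s i)))
    (tendsto_measure_iUnion_atTop (μ := μ) hmono) (Or.inl (measure_ne_top μ (⋃ i, s i)))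

variable [NormedSpace ℝ E] {S : Submodule ℝ (Lp E p μ)}

theorem indicatorConstLp_compl_mem {s : Set α} (hs : MeasurableSet s) {x : E}
    (huniv : indicatorConstLp p MeasurableSet.univ (measure_ne_top μ _) x ∈ S)
    (h : indicatorConstLp p hs (measure_ne_top μ _) x ∈ S) :
    indicatorConstLp p hs.compl (measure_ne_top μ _) x ∈ S := by
  have hadd := indicatorConstLp_disjoint_union (p := p) (c := x) hs hs.compl
    (measure_ne_top μ _) (measure_ne_top μ _) disjoint_compl_right
  simp only [union_compl_self] at hadd
  rw [← sub_eq_of_eq_add' hadd]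
  exact S.sub_mem huniv h

variable [Fact (1 ≤ p)]

theorem indicatorConstLp_iUnion_mem (hp : p ≠ ∞) (hS : IsClosed (S : Set (Lp E p μ)))
    {s : ℕ → Set α} (hs : ∀ n, MeasurableSet (s n)) (hd : Pairwise (Function.onFun Disjoint s))
    {x : E} (h : ∀ n, indicatorConstLp p (hs n) (measure_ne_top μ _) x ∈ S) :
    indicatorConstLp p (MeasurableSet.iUnion hs) (measure_ne_top μ _) x ∈ S := by
  have hacc : ∀ n, MeasurableSet (accumulate s n) := fun n =>
    MeasurableSet.biUnion (to_countable _) fun i _ => hs i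
  have hmem : ∀ n, indicatorConstLp p (hacc n) (measure_ne_top μ _) x ∈ S := by
    intro n
    induction n with
    | zero => simpa only [accumulate_zero_nat] using h 0
    | succ n ih =>
      have hdisj : Disjoint (accumulate s n) (s (n + 1)) := disjoint_accumulate hd n.lt_succ_self
      simp only [accumulate_succ]
      rw [indicatorConstLp_disjoint_union (hacc n) (hs (n + 1)) (measure_ne_top μ _)
        (measure_ne_top μ _) hdisj]
      exact S.add_mem ih (h (n + 1))
  have hlim := tendsto_indicatorConstLp_iUnion_of_monotone (μ := μ) hp hacc monotone_accumulate x
  simp only [iUnion_accumulate] at hlim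
  exact hS.mem_of_tendsto hlim (Filter.Eventually.of_forall hmem)

theorem eq_top_of_indicatorConstLp_mem (hp : p ≠ ∞) (hS : IsClosed (S : Set (Lp E p μ)))
    {𝒞 : Set (Set α)} (hgen : m = MeasurableSpace.generateFrom 𝒞) (hpi : IsPiSystem 𝒞)
    (huniv : ∀ x, indicatorConstLp p MeasurableSet.univ (measure_ne_top μ _) x ∈ S)
    (hmem : ∀ (s : Set α) (hs : MeasurableSet s), s ∈ 𝒞 →
      ∀ x, indicatorConstLp p hs (measure_ne_top μ _) x ∈ S) : S = ⊤ := by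
  have hind : ∀ (s : Set α) (hs : MeasurableSet s) (x : E),
      indicatorConstLp p hs (measure_ne_top μ _) x ∈ S := by
    intro s hs x
    induction s, hs using MeasurableSpace.induction_on_inter hgen hpi with
    | empty => simp
    | basic t ht => exact hmem t _ ht x
    | compl t ht ih => exact indicatorConstLp_compl_mem ht (huniv x) ih
    | iUnion f hd hm ih => exact indicatorConstLp_iUnion_mem hp hS hm hd ih
  rw [eq_top_iff]
  rintro f -
  induction f using Lp.induction hp with
  | indicatorConst c hs hμ =>
    rw [Lp.simpleFunc.coe_indicatorConst]
    exact hind _ hs c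
  | add hf hg _ h1 h2 => exact S.add_mem h1 h2
  | isClosed => exact hS

end Density

section StepFunctions

variable {T : ℝ} {p : ℝ≥0∞} {H H' : Type*} [NormedAddCommGroup H] [NormedAddCommGroup H']

/-- The step function `1_{(0, t]} x` as an element of `L^p([0, T]; H)`. -/
def stepLp (T : ℝ) (p : ℝ≥0∞) (t : ℝ) (x : H) : Lp H p (timeMeasure T) :=
  indicatorConstLp p (measurableSet_Ioc : MeasurableSet (Ioc 0 t))
    (measure_ne_top (timeMeasure T) _) x

theorem coeFn_stepLp (t : ℝ) (x : H) :
    stepLp T p t x =ᵐ[timeMeasure T] (Ioc 0 t).indicator fun _ => x :=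
  indicatorConstLp_coeFn

theorem indicatorConstLp_Ioc_eq_sub {s t : ℝ} (hs : 0 ≤ s) (hst : s ≤ t) (x : H) :
    indicatorConstLp p (measurableSet_Ioc : MeasurableSet (Ioc s t))
      (measure_ne_top (timeMeasure T) _) x = stepLp T p t x - stepLp T p s x := by
  rw [eq_sub_iff_add_eq, add_comm, stepLp, stepLp,
    ← indicatorConstLp_disjoint_union _ _ _ _ (Ioc_disjoint_Ioc_of_le le_rfl)]
  simp only [Ioc_union_Ioc_eq_Ioc hs hst]

theorem compLpL_stepLp [NormedSpace ℝ H] [NormedSpace ℝ H'] [Fact (1 ≤ p)] (L : H →L[ℝ] H')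
    (t : ℝ) (x : H) : L.compLpL p (timeMeasure T) (stepLp T p t x) = stepLp T p t (L x) := by
  refine Lp.ext ((L.coeFn_compLpL _).trans ?_)
  filter_upwards [coeFn_stepLp (T := T) (p := p) t x, coeFn_stepLp (T := T) (p := p) t (L x)]
    with u hx hLx
  rw [hx, hLx]
  exact congrFun (indicator_comp_of_zero (map_zero L)).symm u

theorem ae_timeMeasure_mem_Ioc (T : ℝ) : ∀ᵐ u ∂timeMeasure T, u ∈ Ioc 0 T := by
  rw [timeMeasure, restrict_Ioc_eq_restrict_Icc.symm]
  exact ae_restrict_mem measurableSet_Ioc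

theorem indicatorConstLp_eq_stepLp {s : Set ℝ} (hs : MeasurableSet s) {t : ℝ}
    (h : ∀ u ∈ Ioc 0 T, u ∈ s ↔ u ≤ t) (x : H) :
    indicatorConstLp p hs (measure_ne_top (timeMeasure T) _) x = stepLp T p t x := by
  refine Lp.ext (indicatorConstLp_coeFn.trans (.trans ?_ (coeFn_stepLp t x).symm))
  filter_upwards [ae_timeMeasure_mem_Ioc T] with u hu
  have hmem : u ∈ s ↔ u ∈ Ioc 0 t := by rw [h u hu, mem_Ioc, and_iff_right hu.1]
  simp only [indicator, hmem]

variable [NormedSpace ℝ H] [NormedSpace ℝ H'] [Fact (1 ≤ p)] [hp : Fact (p ≠ ∞)]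

theorem eq_top_of_stepLp_mem {S : Submodule ℝ (Lp H p (timeMeasure T))}
    (hS : IsClosed (S : Set (Lp H p (timeMeasure T))))
    (hmem : ∀ (t : Icc 0 T) (x : H), stepLp T p t x ∈ S) : S = ⊤ := by
  rcases lt_or_ge T 0 with hT | hT
  · rw [eq_top_iff]
    rintro f -
    have hf : f = 0 := Lp.ext <| (ae_timeMeasure_mem_Ioc T).mono fun u hu =>
      absurd (hu.1.trans_le hu.2) hT.not_gt
    exact hf ▸ S.zero_mem
  refine eq_top_of_indicatorConstLp_mem hp.out hS
    (borel_eq_generateFrom_Iic ℝ ▸ BorelSpace.measurable_eq) isPiSystem_Iic (fun x => ?_) ?_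
  · rw [indicatorConstLp_eq_stepLp MeasurableSet.univ (t := T) (by simp +contextual)]
    exact hmem ⟨T, hT, le_rfl⟩ x
  · rintro _ hs ⟨a, rfl⟩ x
    rw [indicatorConstLp_eq_stepLp hs (t := projIcc 0 T hT a) fun u hu => ?_]
    · exact hmem _ x
    · simp [coe_projIcc, hu.2, hu.1.not_ge]

theorem ext_of_stepLp {A B : Lp H p (timeMeasure T) →L[ℝ] H'}
    (h : ∀ (t : Icc 0 T) (x : H), A (stepLp T p t x) = B (stepLp T p t x)) : A = B := by
  have htop := eq_top_of_stepLp_mem (S := LinearMap.eqLocus A.toLinearMap B.toLinearMap)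
    (isClosed_eq A.continuous B.continuous) h
  exact ContinuousLinearMap.coe_injective (LinearMap.eqLocus_eq_top.1 htop)

theorem ext₂_of_stepLp {A B : Lp H p (timeMeasure T) →L[ℝ] Lp H p (timeMeasure T) →L[ℝ] H'}
    (h : ∀ (t s : Icc 0 T) (x y : H),
      A (stepLp T p t x) (stepLp T p s y) = B (stepLp T p t x) (stepLp T p s y)) : A = B :=
  ext_of_stepLp fun t x => ext_of_stepLp fun s y => h t s x y

end StepFunctions

section StepCovariance

variable {T : ℝ} {φ : ℝ → ℝ → ℝ} {p : ℝ≥0∞} {H : Type*} [NormedAddCommGroup H]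
  [InnerProductSpace ℝ H]

theorem KernelCondition.setIntegral_Ioc_prod (hφ : KernelCondition T φ p) (t s : Icc (0 : ℝ) T) :
    ∫ z in Ioc 0 (t : ℝ) ×ˢ Ioc 0 (s : ℝ), φ z.1 z.2 ∂((timeMeasure T).prod (timeMeasure T)) =
      kernelCov φ t s := by
  have hrestrict : ∀ r : Icc (0 : ℝ) T, (timeMeasure T).restrict (Ioc 0 r) =
      volume.restrict (Ioc 0 (r : ℝ)) := fun r => by
    rw [Measure.restrict_restrict measurableSet_Ioc, inter_eq_self_of_subset_left]
    exact Ioc_subset_Icc_self.trans (Icc_subset_Icc_right r.2.2)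
  have hint := hφ.integrable.restrict (s := Ioc 0 (t : ℝ) ×ˢ Ioc 0 (s : ℝ))
  rw [← Measure.prod_restrict, hrestrict, hrestrict] at hint ⊢
  rw [integral_prod_symm _ hint, kernelCov, intervalIntegral.integral_of_le s.2.1]
  simp_rw [intervalIntegral.integral_of_le t.2.1]

theorem KernelCondition.kernelForm_stepLp (hφ : KernelCondition T φ p) (t s : Icc (0 : ℝ) T)
    (x y : H) :
    kernelForm (timeMeasure T) φ (stepLp T p t x) (stepLp T p s y) = ⟪x, y⟫ * kernelCov φ t s := by
  have hind : ∀ z : ℝ × ℝ, ⟪(Ioc 0 (t : ℝ)).indicator (fun _ => x) z.1,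
      (Ioc 0 (s : ℝ)).indicator (fun _ => y) z.2⟫ * φ z.1 z.2 =
      ⟪x, y⟫ * (Ioc 0 (t : ℝ) ×ˢ Ioc 0 (s : ℝ)).indicator (fun z : ℝ × ℝ => φ z.1 z.2) z := by
    intro z
    by_cases h1 : z.1 ∈ Ioc 0 (t : ℝ) <;> by_cases h2 : z.2 ∈ Ioc 0 (s : ℝ) <;>
      simp [indicator, h1, h2, -mem_Ioc]
  rw [kernelForm_congr (coeFn_stepLp _ x) (coeFn_stepLp _ y)]
  simp_rw [kernelForm, hind, integral_const_mul]
  rw [integral_indicator (measurableSet_Ioc.prod measurableSet_Ioc), hφ.setIntegral_Ioc_prod]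

end StepCovariance

section CompLp

variable {α : Type*} [MeasurableSpace α] {μ : Measure α} {p : ℝ≥0∞} {E F G : Type*}
  [NormedAddCommGroup E] [NormedSpace ℝ E] [NormedAddCommGroup F] [NormedSpace ℝ F]
  [NormedAddCommGroup G] [NormedSpace ℝ G]

theorem compLpL_compLpL [Fact (1 ≤ p)] (B : F →L[ℝ] G) (A : E →L[ℝ] F) (f : Lp E p μ) :
    B.compLpL p μ (A.compLpL p μ f) = (B ∘L A).compLpL p μ f := by
  refine Lp.ext ?_
  filter_upwards [B.coeFn_compLpL (A.compLpL p μ f), A.coeFn_compLpL f, (B ∘L A).coeFn_compLpL f]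
    with x h1 h2 h3
  rw [h1, h2, h3, ContinuousLinearMap.comp_apply]

theorem compLpL_toLp [Fact (1 ≤ p)] (A : E →L[ℝ] F) {f : α → E} (hf : MemLp f p μ) :
    A.compLpL p μ hf.toLp = (A.comp_memLp' hf).toLp := by
  refine Lp.ext ?_
  filter_upwards [A.coeFn_compLpL hf.toLp, hf.coeFn_toLp, (A.comp_memLp' hf).coeFn_toLp]
    with x h1 h2 h3
  rw [h1, h2, h3, Function.comp_apply]

end CompLp

section Extension

theorem exists_clm_apply_eq_of_inner_eq {ι E F : Type*} [NormedAddCommGroup E] [NormedSpace ℝ E]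
    [NormedAddCommGroup F] [InnerProductSpace ℝ F] [CompleteSpace F] {v : ι → E} {b : ι → F}
    (hv : Dense (Submodule.span ℝ (range v) : Set E)) (B : E →L[ℝ] E →L[ℝ] ℝ)
    (hb : ∀ i j, ⟪b i, b j⟫ = B (v i) (v j)) :
    ∃ A : E →L[ℝ] F, ∀ i, A (v i) = b i := by
  let e : (ι →₀ ℝ) →ₗ[ℝ] E := Finsupp.linearCombination ℝ v
  let β : (ι →₀ ℝ) →ₗ[ℝ] F := Finsupp.linearCombination ℝ b
  have hinner : ∀ ξ, ⟪β ξ, β ξ⟫ = B (e ξ) (e ξ) := fun ξ => by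
    simp only [β, e, Finsupp.linearCombination_apply, Finsupp.sum, sum_inner, inner_sum, map_sum,
      _root_.sum_apply, map_smul, _root_.smul_apply, real_inner_smul_left, real_inner_smul_right,
      smul_eq_mul, hb, Finset.mul_sum]
  have hnorm : ∀ ξ, ‖β ξ‖ ≤ √‖B‖ * ‖e ξ‖ := fun ξ => by
    refine (pow_le_pow_iff_left₀ (by positivity) (by positivity) two_ne_zero).1 ?_
    calc ‖β ξ‖ ^ 2 = B (e ξ) (e ξ) := by rw [← real_inner_self_eq_norm_sq, hinner]
      _ ≤ ‖B‖ * ‖e ξ‖ * ‖e ξ‖ := (le_abs_self _).trans (B.le_opNorm₂ _ _)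
      _ = (√‖B‖ * ‖e ξ‖) ^ 2 := by rw [mul_pow, Real.sq_sqrt (norm_nonneg B)]; ring
  have hdense : DenseRange e := by
    rwa [DenseRange, ← LinearMap.coe_range, Finsupp.range_linearCombination]
  refine ⟨β.extendOfNorm e, fun i => ?_⟩
  simpa [e, β] using LinearMap.extendOfNorm_eq hdense ⟨_, hnorm⟩ (Finsupp.single i 1)

end Extension

section WienerIntegral

variable {Ω : Type*} [MeasurableSpace Ω] {P : Measure Ω}
  {H H' : Type*} [NormedAddCommGroup H] [InnerProductSpace ℝ H] [NormedAddCommGroup H']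
  [InnerProductSpace ℝ H'] {T : ℝ} {φ : ℝ → ℝ → ℝ} {p : ℝ≥0∞} {C : ℝ≥0}

/-- The element `X x` of `L²(Ω; H)` for a real random variable `X ∈ L²(Ω)` and a vector `x ∈ H`. -/
def smulLp (X : Lp ℝ 2 P) (x : H) : Lp H 2 P :=
  (ContinuousLinearMap.toSpanSingleton ℝ x).compLpL 2 P X

theorem coeFn_smulLp (X : Lp ℝ 2 P) (x : H) : smulLp X x =ᵐ[P] fun ω => X ω • x :=
  ContinuousLinearMap.coeFn_compLpL _ X

theorem smulLp_real (X : Lp ℝ 2 P) (c : ℝ) : smulLp X c = c • X := by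
  refine Lp.ext ?_
  filter_upwards [coeFn_smulLp X c, Lp.coeFn_smul c X] with ω h1 h2
  rw [h1, h2, Pi.smul_apply, smul_eq_mul, smul_eq_mul, mul_comm]

theorem compLpL_smulLp (L : H →L[ℝ] H') (X : Lp ℝ 2 P) (x : H) :
    L.compLpL 2 P (smulLp X x) = smulLp X (L x) := by
  refine Lp.ext ?_
  filter_upwards [L.coeFn_compLpL (smulLp X x), coeFn_smulLp X x, coeFn_smulLp X (L x)]
    with ω h1 h2 h3
  rw [h1, h2, h3, map_smul]

theorem inner_smulLp_toLp {X Y : Ω → ℝ} (hX : MemLp X 2 P) (hY : MemLp Y 2 P) (x y : H) :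
    ⟪smulLp hX.toLp x, smulLp hY.toLp y⟫ = ⟪x, y⟫ * ∫ ω, X ω * Y ω ∂P := by
  rw [L2.inner_def, ← integral_const_mul]
  refine integral_congr_ae ?_
  filter_upwards [coeFn_smulLp hX.toLp x, coeFn_smulLp hY.toLp y, hX.coeFn_toLp, hY.coeFn_toLp]
    with ω h1 h2 h3 h4
  rw [h1, h2, h3, h4, real_inner_smul_left, real_inner_smul_right]
  ring

/-- `g` is a square-integrable process with second moments `∫ g t * g s = R(t, s)`, which is what
the construction of the integral with respect to `g` needs. -/
structure HasKernelCov (P : Measure Ω) (φ : ℝ → ℝ → ℝ) (g : Icc (0 : ℝ) T → Ω → ℝ) : Prop where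
  memLp : ∀ t, MemLp (g t) 2 P
  integral_mul : ∀ t s, ∫ ω, g t ω * g s ω ∂P = kernelCov φ t s

variable {g g' : Icc (0 : ℝ) T → Ω → ℝ}

theorem HasKernelCov.ae_eq_zero (hg : HasKernelCov P φ g) {t : Icc (0 : ℝ) T} (ht : (t : ℝ) = 0) :
    g t =ᵐ[P] 0 := by
  have hsq : ∫ ω, g t ω * g t ω ∂P = 0 := by
    rw [hg.integral_mul, kernelCov, ht, intervalIntegral.integral_same]
  filter_upwards [(integral_eq_zero_iff_of_nonneg (fun ω => mul_self_nonneg _)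
    ((hg.memLp t).integrable_mul (hg.memLp t))).1 hsq] with ω hω
  exact mul_self_eq_zero.1 hω

variable [Fact (1 ≤ p)] {I J : Lp H p (timeMeasure T) →L[ℝ] Lp H 2 P}

theorem isWienerIntegral_iff (hg : HasKernelCov P φ g) :
    IsWienerIntegral P p g I ↔
      ∀ (t : Icc (0 : ℝ) T) (x : H), I (stepLp T p t x) = smulLp (hg.memLp t).toLp x := by
  constructor
  · intro h t x
    let zero : Icc (0 : ℝ) T := ⟨0, le_rfl, t.2.1.trans t.2.2⟩
    refine Lp.ext ?_
    filter_upwards [h zero t t.2.1 x, coeFn_smulLp (hg.memLp t).toLp x, (hg.memLp t).coeFn_toLp,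
      hg.ae_eq_zero (t := zero) rfl] with ω h1 h2 h3 h4
    rw [h2, h3]
    exact h1.trans (by rw [h4, Pi.zero_apply, sub_zero])
  · intro h s t hst x
    rw [indicatorConstLp_Ioc_eq_sub s.2.1 hst, map_sub, h, h]
    filter_upwards [Lp.coeFn_sub (smulLp (hg.memLp t).toLp x) (smulLp (hg.memLp s).toLp x),
      coeFn_smulLp (hg.memLp t).toLp x, (hg.memLp t).coeFn_toLp,
      coeFn_smulLp (hg.memLp s).toLp x, (hg.memLp s).coeFn_toLp] with ω h1 h2 h3 h4 h5
    rw [h1, Pi.sub_apply, h2, h3, h4, h5, sub_smul]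

variable [hp : Fact (p ≠ ∞)]

theorem dense_span_range_stepLp :
    Dense (Submodule.span ℝ (range fun q : Icc (0 : ℝ) T × H => stepLp T p q.1 q.2) :
      Set (Lp H p (timeMeasure T))) :=
  Submodule.dense_iff_topologicalClosure_eq_top.2 <|
    eq_top_of_stepLp_mem (Submodule.isClosed_topologicalClosure _) fun t x =>
      Submodule.le_topologicalClosure _ (Submodule.subset_span ⟨(t, x), rfl⟩)

theorem exists_isWienerIntegral [CompleteSpace H] (hφ : KernelCondition T φ p)
    (hg : HasKernelCov P φ g) :
    ∃ I : Lp H p (timeMeasure T) →L[ℝ] Lp H 2 P, IsWienerIntegral P p g I := by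
  obtain ⟨C, hC⟩ := hφ.exists_isBoundedKernel
  obtain ⟨I, hI⟩ := exists_clm_apply_eq_of_inner_eq (dense_span_range_stepLp (H := H))
    (b := fun q => smulLp (hg.memLp q.1).toLp q.2) hC.kernelFormL fun q r => by
      rw [inner_smulLp_toLp, hg.integral_mul, hC.kernelFormL_apply, hφ.kernelForm_stepLp]
  exact ⟨I, (isWienerIntegral_iff hg).2 fun t x => hI (t, x)⟩

theorem isWienerIntegral_wienerIntegralL [CompleteSpace H] (hφ : KernelCondition T φ p)
    (hg : HasKernelCov P φ g) :
    IsWienerIntegral P p g (wienerIntegralL P p g : Lp H p (timeMeasure T) →L[ℝ] Lp H 2 P) := by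
  have h : ∃ I : Lp H p (timeMeasure T) →L[ℝ] Lp H 2 P, IsWienerIntegral P p g I :=
    exists_isWienerIntegral hφ hg
  rw [wienerIntegralL, dif_pos h]
  exact h.choose_spec

namespace IsWienerIntegral

theorem unique (hg : HasKernelCov P φ g) (hI : IsWienerIntegral P p g I)
    (hJ : IsWienerIntegral P p g J) : I = J := by
  rw [isWienerIntegral_iff hg] at hI hJ
  exact ext_of_stepLp fun t x => (hI t x).trans (hJ t x).symm

theorem compLpL_apply {J : Lp H' p (timeMeasure T) →L[ℝ] Lp H' 2 P} (hg : HasKernelCov P φ g)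
    (hI : IsWienerIntegral P p g I) (hJ : IsWienerIntegral P p g J) (L : H →L[ℝ] H')
    (f : Lp H p (timeMeasure T)) :
    L.compLpL 2 P (I f) = J (L.compLpL p (timeMeasure T) f) := by
  rw [isWienerIntegral_iff hg] at hI hJ
  have h : L.compLpL 2 P ∘L I = J ∘L L.compLpL p (timeMeasure T) :=
    ext_of_stepLp fun t x => by
      simp only [ContinuousLinearMap.comp_apply, hI, hJ, compLpL_stepLp, compLpL_smulLp]
  exact DFunLike.congr_fun h f

theorem inner_apply_eq {B : Lp H p (timeMeasure T) →L[ℝ] Lp H p (timeMeasure T) →L[ℝ] ℝ}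
    (hg : HasKernelCov P φ g) (hg' : HasKernelCov P φ g')
    (hI : IsWienerIntegral P p g I) (hJ : IsWienerIntegral P p g' J)
    (hB : ∀ (t s : Icc (0 : ℝ) T) (x y : H),
      B (stepLp T p t x) (stepLp T p s y) = ⟪x, y⟫ * ∫ ω, g t ω * g' s ω ∂P)
    (f k : Lp H p (timeMeasure T)) : ⟪I f, J k⟫ = B f k := by
  rw [isWienerIntegral_iff hg] at hI
  rw [isWienerIntegral_iff hg'] at hJ
  have h : (innerSL ℝ).bilinearComp I J = B := ext₂_of_stepLp fun t s x y => by
    rw [ContinuousLinearMap.bilinearComp_apply, innerSL_apply_apply, hI, hJ, inner_smulLp_toLp, hB]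
  exact DFunLike.congr_fun (DFunLike.congr_fun h f) k

theorem inner_eq (hφ : KernelCondition T φ p) (hg : HasKernelCov P φ g)
    (hI : IsWienerIntegral P p g I) (f k : Lp H p (timeMeasure T)) :
    ⟪I f, I k⟫ = kernelForm (timeMeasure T) φ f k := by
  obtain ⟨C, hC⟩ := hφ.exists_isBoundedKernel
  exact inner_apply_eq hg hg hI hI (B := hC.kernelFormL) (fun t s x y => by
    rw [hC.kernelFormL_apply, hφ.kernelForm_stepLp, hg.integral_mul]) f k

theorem inner_eq_zero (hg : HasKernelCov P φ g) (hg' : HasKernelCov P φ g')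
    (horth : ∀ t s, ∫ ω, g t ω * g' s ω ∂P = 0)
    (hI : IsWienerIntegral P p g I) (hJ : IsWienerIntegral P p g' J)
    (f k : Lp H p (timeMeasure T)) : ⟪I f, J k⟫ = 0 :=
  inner_apply_eq hg hg' hI hJ (B := 0) (fun t s x y => by simp [horth]) f k

theorem norm_le (hφ : KernelCondition T φ p) (hC : IsBoundedKernel (timeMeasure T) φ p C)
    (hg : HasKernelCov P φ g) (hI : IsWienerIntegral P p g I) : ‖I‖ ≤ √(4 * C) := by
  refine I.opNorm_le_bound (Real.sqrt_nonneg _) fun f =>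
    (pow_le_pow_iff_left₀ (by positivity) (by positivity) two_ne_zero).1 ?_
  rw [← real_inner_self_eq_norm_sq, hI.inner_eq hφ hg, mul_pow, Real.sq_sqrt (by positivity)]
  exact hC.kernelForm_self_le f

theorem apply_mem {I : Lp ℝ p (timeMeasure T) →L[ℝ] Lp ℝ 2 P} (hg : HasKernelCov P φ g)
    (hI : IsWienerIntegral P p g I) {S : Submodule ℝ (Lp ℝ 2 P)}
    (hS : IsClosed (S : Set (Lp ℝ 2 P))) (hmem : ∀ t, (hg.memLp t).toLp ∈ S)
    (f : Lp ℝ p (timeMeasure T)) : I f ∈ S := by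
  rw [isWienerIntegral_iff hg] at hI
  have htop := eq_top_of_stepLp_mem (S := S.comap I.toLinearMap) (hS.preimage I.continuous)
    fun t x => by
      rw [Submodule.mem_comap, ContinuousLinearMap.coe_coe, hI, smulLp_real]
      exact S.smul_mem _ (hmem t)
  exact (Submodule.eq_top_iff'.1 htop) f

end IsWienerIntegral

theorem existsUnique_isWienerIntegral [CompleteSpace H] (hφ : KernelCondition T φ p)
    (hg : HasKernelCov P φ g) :
    ∃! I : Lp H p (timeMeasure T) →L[ℝ] Lp H 2 P, IsWienerIntegral P p g I :=
  existsUnique_of_exists_of_unique (exists_isWienerIntegral hφ hg) fun _ _ hI hJ => hI.unique hg hJ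

end WienerIntegral

section GaussianSpace

variable {Ω : Type*} [MeasurableSpace Ω] {P : Measure Ω}

/-- The random variable `X` is centred Gaussian (its variance is then necessarily `‖X‖²`). -/
def IsCentredGaussian (X : Lp ℝ 2 P) : Prop :=
  P.map X = gaussianReal 0 (‖X‖₊ ^ 2)

theorem IsCentredGaussian.charFun_map {X : Lp ℝ 2 P} (hX : IsCentredGaussian X) (t : ℝ) :
    charFun (P.map X) t = Complex.exp (-(‖X‖ ^ 2 * t ^ 2 / 2 : ℝ)) := by
  rw [hX, charFun_gaussianReal]
  push_cast
  simp

theorem isCentredGaussian_of_hasGaussianLaw {X : Lp ℝ 2 P} (hX : HasGaussianLaw X P)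
    (h0 : ∫ ω, X ω ∂P = 0) : IsCentredGaussian X := by
  rw [IsCentredGaussian, hX.map_eq_gaussianReal, h0,
    variance_of_integral_eq_zero hX.aemeasurable h0]
  congr 1
  ext
  rw [Real.coe_toNNReal _ (integral_nonneg fun ω => sq_nonneg _), NNReal.coe_pow, coe_nnnorm,
    ← real_inner_self_eq_norm_sq, L2.inner_def]
  simp only [real_inner_self_eq_norm_sq, Real.norm_eq_abs, sq_abs]

theorem isClosed_setOf_isCentredGaussian [IsProbabilityMeasure P] :
    IsClosed {X : Lp ℝ 2 P | IsCentredGaussian X} := by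
  refine IsSeqClosed.isClosed fun X Y hX hXY => ?_
  have hlaw : ∀ Z : Lp ℝ 2 P, AEMeasurable Z P := fun Z => (Lp.aestronglyMeasurable Z).aemeasurable
  have hdist := ProbabilityMeasure.tendsto_iff_tendsto_charFun.1
    ((tendstoInMeasure_of_tendsto_Lp hXY).tendstoInDistribution fun n => hlaw (X n)).tendsto
  have hchar (t : ℝ) :
      charFun (P.map Y) t = Complex.exp (-(‖Y‖ ^ 2 * t ^ 2 / 2 : ℝ)) := by
    refine tendsto_nhds_unique (hdist t) ?_
    simp only [ProbabilityMeasure.coe_mk, (hX _).charFun_map]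
    have hcont : Continuous fun Z : Lp ℝ 2 P => Complex.exp (-(‖Z‖ ^ 2 * t ^ 2 / 2 : ℝ)) := by
      fun_prop
    exact (hcont.tendsto Y).comp hXY
  have : IsProbabilityMeasure (P.map Y) := Measure.isProbabilityMeasure_map (hlaw Y)
  refine Measure.ext_of_charFun (funext fun t => ?_)
  rw [hchar, charFun_gaussianReal]
  push_cast
  simp

/-- Gaussian (Hilbert) spaces: subspaces of `L²(Ω)` consisting of centred Gaussian variables. -/
def IsGaussianSpace (G : Submodule ℝ (Lp ℝ 2 P)) : Prop :=
  ∀ X ∈ G, IsCentredGaussian X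

theorem IsGaussianSpace.topologicalClosure [IsProbabilityMeasure P] {G : Submodule ℝ (Lp ℝ 2 P)}
    (hG : IsGaussianSpace G) : IsGaussianSpace G.topologicalClosure :=
  fun _ hX => closure_minimal hG isClosed_setOf_isCentredGaussian hX

theorem isGaussianSpace_span_range [IsFiniteMeasure P] {ι : Type*} {X : ι → Lp ℝ 2 P}
    (hX : IsGaussianProcess (fun i => X i) P) (h0 : ∀ i, ∫ ω, X i ω ∂P = 0) :
    IsGaussianSpace (Submodule.span ℝ (range X)) := by
  intro Y hY
  obtain ⟨c, rfl⟩ := Finsupp.mem_span_range_iff_exists_finsupp.1 hY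
  have hcX : ∀ᵐ ω ∂P, ∀ i : c.support, (c i • X i : Lp ℝ 2 P) ω = c i • X i ω :=
    ae_all_iff.2 fun i => Lp.coeFn_smul (c i) (X i)
  have hsum : (c.sum fun i a => a • X i : Lp ℝ 2 P) =ᵐ[P]
      fun ω => ∑ i ∈ c.support, c i • X i ω := by
    filter_upwards [hcX, Lp.coeFn_finsetSum c.support fun i => c i • X i] with ω h1 h2
    rw [Finsupp.sum, h2, Finset.sum_apply]
    exact Finset.sum_congr rfl fun i hi => h1 ⟨i, hi⟩
  refine isCentredGaussian_of_hasGaussianLaw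
    ((hX.smul c).hasGaussianLaw_fun_sum (I := c.support) |>.congr hsum.symm) ?_
  have hint : ∀ i, Integrable (fun ω => c i • X i ω) P := fun i =>
    ((Lp.memLp (X i)).integrable one_le_two).smul (c i)
  rw [integral_congr_ae hsum, integral_finsetSum _ fun i _ => hint i]
  simp only [smul_eq_mul, integral_const_mul, h0, mul_zero, Finset.sum_const_zero]

theorem isGaussianProcess_of_iIndepFun {ι κ : Type*} {g : ι → κ → Ω → ℝ}
    (hg : ∀ n, IsGaussianProcess (g n) P) (hind : iIndepFun (fun n ω t => g n t ω) P) :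
    IsGaussianProcess (fun (q : ι × κ) ω => g q.1 q.2 ω) P := by
  classical
  refine ⟨fun I => ?_⟩
  let N := I.image Prod.fst
  let S := I.image Prod.snd
  have hind' : iIndepFun (fun (n : N) ω => S.restrict (fun t => g n t ω)) P :=
    (hind.precomp (g := fun n : N => (n : ι)) Subtype.val_injective).comp
      (fun _ path => S.restrict path) fun _ => Finset.measurable_restrict S
  have hlaw := hind'.hasGaussianLaw fun n : N => (hg n).hasGaussianLaw S
  let L : (N → S → ℝ) →L[ℝ] (I → ℝ) := ContinuousLinearMap.pi fun q =>
    (ContinuousLinearMap.proj (R := ℝ) (φ := fun _ : S => ℝ)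
      ⟨q.1.2, Finset.mem_image_of_mem _ q.2⟩) ∘L
    (ContinuousLinearMap.proj (R := ℝ) (φ := fun _ : N => S → ℝ)
      ⟨q.1.1, Finset.mem_image_of_mem _ q.2⟩)
  exact hlaw.map_fun L

theorem exists_isGaussianSpace [IsProbabilityMeasure P] {ι κ : Type*} {g : ι → κ → Ω → ℝ}
    (hg : ∀ n, IsGaussianProcess (g n) P) (hmean : ∀ n t, ∫ ω, g n t ω ∂P = 0)
    (hind : iIndepFun (fun n ω t => g n t ω) P) (hg2 : ∀ n t, MemLp (g n t) 2 P) :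
    ∃ G : Submodule ℝ (Lp ℝ 2 P), IsGaussianSpace G ∧ IsClosed (G : Set (Lp ℝ 2 P)) ∧
      ∀ n t, (hg2 n t).toLp ∈ G := by
  let X : ι × κ → Lp ℝ 2 P := fun q => (hg2 q.1 q.2).toLp
  have hX : ∀ q, g q.1 q.2 =ᵐ[P] X q := fun q => (hg2 q.1 q.2).coeFn_toLp.symm
  exact ⟨(Submodule.span ℝ (range X)).topologicalClosure,
    (isGaussianSpace_span_range ((isGaussianProcess_of_iIndepFun hg hind).congr hX) fun q =>
      (integral_congr_ae (hX q)).symm.trans (hmean q.1 q.2)).topologicalClosure,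
    Submodule.isClosed_topologicalClosure _,
    fun n t => Submodule.le_topologicalClosure _ (Submodule.subset_span ⟨(n, t), rfl⟩)⟩

variable {E F : Type*} [NormedAddCommGroup E] [NormedSpace ℝ E] [NormedAddCommGroup F]
  [NormedSpace ℝ F] {G : Submodule ℝ (Lp ℝ 2 P)}

/-- The elements `X` of `L²(Ω; E)` with `L X ∈ G` for all continuous linear functionals `L`.
If `G` is a Gaussian space, these are jointly Gaussian. -/
def weakSubmodule (E : Type*) [NormedAddCommGroup E] [NormedSpace ℝ E]
    (G : Submodule ℝ (Lp ℝ 2 P)) : Submodule ℝ (Lp E 2 P) :=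
  ⨅ L : E →L[ℝ] ℝ, G.comap (L.compLpL 2 P).toLinearMap

theorem mem_weakSubmodule {X : Lp E 2 P} :
    X ∈ weakSubmodule E G ↔ ∀ L : E →L[ℝ] ℝ, L.compLpL 2 P X ∈ G := by
  simp only [weakSubmodule, Submodule.mem_iInf, Submodule.mem_comap, ContinuousLinearMap.coe_coe]

theorem isClosed_weakSubmodule (hG : IsClosed (G : Set (Lp ℝ 2 P))) :
    IsClosed (weakSubmodule E G : Set (Lp E 2 P)) := by
  rw [weakSubmodule, Submodule.coe_iInf]
  exact isClosed_iInter fun L => hG.preimage (L.compLpL 2 P).continuous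

theorem compLpL_mem_weakSubmodule {X : Lp E 2 P} (hX : X ∈ weakSubmodule E G) (A : E →L[ℝ] F) :
    A.compLpL 2 P X ∈ weakSubmodule F G := by
  refine mem_weakSubmodule.2 fun L => ?_
  rw [compLpL_compLpL]
  exact mem_weakSubmodule.1 hX _

namespace IsGaussianSpace

theorem hasGaussianLaw [MeasurableSpace E] [BorelSpace E] (hG : IsGaussianSpace G) {X : Lp E 2 P}
    (hX : X ∈ weakSubmodule E G) : HasGaussianLaw X P := by
  refine ⟨isGaussian_of_map_eq_gaussianReal fun L => ?_⟩
  rw [AEMeasurable.map_map_of_aemeasurable L.continuous.aemeasurable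
    (Lp.aestronglyMeasurable X).aemeasurable]
  exact ⟨_, _, (Measure.map_congr (L.coeFn_compLpL X)).symm.trans
    (hG _ (mem_weakSubmodule.1 hX L))⟩

theorem isGaussianProcess [MeasurableSpace E] [BorelSpace E] [SecondCountableTopology E]
    (hG : IsGaussianSpace G) {κ : Type*} {X : κ → Lp E 2 P} (hX : ∀ i, X i ∈ weakSubmodule E G) :
    IsGaussianProcess (fun i => X i) P := by
  classical
  refine ⟨fun I => ?_⟩
  let ι (i : I) : E →L[ℝ] (I → E) := ContinuousLinearMap.single ℝ (fun _ : I => E) i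
  let Y : Lp (I → E) 2 P := ∑ i : I, (ι i).compLpL 2 P (X i)
  have hY : Y =ᵐ[P] fun ω => I.restrict fun i => X i ω := by
    have hι : ∀ᵐ ω ∂P, ∀ i : I, (ι i).compLpL 2 P (X i) ω = Pi.single i (X i ω) :=
      ae_all_iff.2 fun i => (ι i).coeFn_compLpL (X i)
    filter_upwards [hι, Lp.coeFn_finsetSum Finset.univ fun i : I => (ι i).compLpL 2 P (X i)]
      with ω h1 h2
    rw [h2, Finset.sum_apply, Finset.sum_congr rfl fun i _ => h1 i]
    exact Finset.univ_sum_single fun i : I => X i ω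
  have hYmem : Y ∈ weakSubmodule (I → E) G :=
    Submodule.sum_mem _ fun i _ => compLpL_mem_weakSubmodule (hX i) (ι i)
  exact (hG.hasGaussianLaw hYmem).congr hY

end IsGaussianSpace

end GaussianSpace

section TraceForm

variable {H : Type*} [NormedAddCommGroup H] [InnerProductSpace ℝ H]

theorem sum_abs_inner_mul_inner_le {ι : Type*} {b : ι → H} (hb : Orthonormal ℝ b) (x y : H)
    (s : Finset ι) : ∑ i ∈ s, |⟪x, b i⟫ * ⟪b i, y⟫| ≤ ‖x‖ * ‖y‖ := by
  have hbessel : ∀ x : H, √(∑ i ∈ s, ‖⟪b i, x⟫‖ ^ 2) ≤ ‖x‖ := fun x =>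
    Real.sqrt_le_iff.2 ⟨norm_nonneg _, hb.sum_inner_products_le x⟩
  calc ∑ i ∈ s, |⟪x, b i⟫ * ⟪b i, y⟫| = ∑ i ∈ s, ‖⟪b i, x⟫‖ * ‖⟪b i, y⟫‖ := by
        simp only [abs_mul, Real.norm_eq_abs, real_inner_comm]
    _ ≤ √(∑ i ∈ s, ‖⟪b i, x⟫‖ ^ 2) * √(∑ i ∈ s, ‖⟪b i, y⟫‖ ^ 2) :=
        Real.sum_mul_le_sqrt_mul_sqrt _ _ _
    _ ≤ ‖x‖ * ‖y‖ := mul_le_mul (hbessel x) (hbessel y) (Real.sqrt_nonneg _) (norm_nonneg _)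

theorem trace_eq_tsum_inner {ι : Type*} (b : HilbertBasis ι ℝ H) {A : H →L[ℝ] H} {u v : ℕ → H}
    (huv : Summable fun n => ‖u n‖ * ‖v n‖) (hA : ∀ z, HasSum (fun n => ⟪u n, z⟫ • v n) (A z)) :
    trace b A = ∑' n, ⟪u n, v n⟫ := by
  have hdiag : ∀ i, ⟪A (b i), b i⟫ = ∑' n, ⟪u n, b i⟫ * ⟪b i, v n⟫ := fun i => by
    have h := ((hA (b i)).mapL (innerSL ℝ (b i))).tsum_eq
    simp only [innerSL_apply_apply, real_inner_smul_right] at h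
    rw [real_inner_comm, h]
  have hle : ∀ (n : ℕ) (s : Finset ι), ∑ i ∈ s, ‖⟪u n, b i⟫ * ⟪b i, v n⟫‖ ≤ ‖u n‖ * ‖v n‖ :=
    fun n s => sum_abs_inner_mul_inner_le b.orthonormal (u n) (v n) s
  have hsum : Summable (Function.uncurry fun n i => ⟪u n, b i⟫ * ⟪b i, v n⟫) :=
    .of_norm <| (summable_prod_of_nonneg fun _ => norm_nonneg _).2
      ⟨fun n => summable_of_sum_le (fun _ => norm_nonneg _) (hle n),
        .of_nonneg_of_le (fun n => tsum_nonneg fun _ => norm_nonneg _)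
          (fun n => Real.tsum_le_of_sum_le (fun _ => norm_nonneg _) (hle n)) huv⟩
  calc trace b A = ∑' i, ∑' n, ⟪u n, b i⟫ * ⟪b i, v n⟫ := tsum_congr hdiag
    _ = ∑' n, ∑' i, ⟪u n, b i⟫ * ⟪b i, v n⟫ := hsum.tsum_comm
    _ = ∑' n, ⟪u n, v n⟫ := tsum_congr fun n => (b.hasSum_inner_mul_inner (u n) (v n)).tsum_eq

variable {U : Type*} [NormedAddCommGroup U] [InnerProductSpace ℝ U]

/-- The bilinear form `(A, B) ↦ ⟪A u, B u⟫` on operators. -/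
def evalForm (H : Type*) [NormedAddCommGroup H] [InnerProductSpace ℝ H] (u : U) :
    (U →L[ℝ] H) →L[ℝ] (U →L[ℝ] H) →L[ℝ] ℝ :=
  (innerSL ℝ).bilinearComp (ContinuousLinearMap.apply ℝ H u) (ContinuousLinearMap.apply ℝ H u)

theorem evalForm_apply (u : U) (A B : U →L[ℝ] H) : evalForm H u A B = ⟪A u, B u⟫ := rfl

theorem norm_evalForm_le (u : U) : ‖evalForm H u‖ ≤ ‖u‖ ^ 2 :=
  ContinuousLinearMap.opNorm_le_bound₂ _ (by positivity) fun A B => by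
    calc ‖evalForm H u A B‖ ≤ ‖A u‖ * ‖B u‖ := norm_inner_le_norm _ _
      _ ≤ (‖A‖ * ‖u‖) * (‖B‖ * ‖u‖) := by gcongr <;> exact ContinuousLinearMap.le_opNorm _ _
      _ = ‖u‖ ^ 2 * ‖A‖ * ‖B‖ := by ring

/-- The bilinear form `(A, B) ↦ ∑_n λ_n ⟪A e_n, B e_n⟫ = Tr (B Q A*)` on operators. -/
def traceForm (H : Type*) [NormedAddCommGroup H] [InnerProductSpace ℝ H] (e : HilbertBasis ℕ ℝ U)
    (lam : ℕ → ℝ) : (U →L[ℝ] H) →L[ℝ] (U →L[ℝ] H) →L[ℝ] ℝ :=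
  ∑' n, lam n • evalForm H (e n)

variable {e : HilbertBasis ℕ ℝ U} {lam : ℕ → ℝ}

theorem hasSum_traceForm (hlam : Summable fun n => |lam n|) :
    HasSum (fun n => lam n • evalForm H (e n)) (traceForm H e lam) := by
  refine (Summable.of_norm_bounded hlam fun n => ?_).hasSum
  rw [norm_smul, Real.norm_eq_abs]
  refine mul_le_of_le_one_right (abs_nonneg _) ((norm_evalForm_le _).trans_eq ?_)
  rw [e.orthonormal.1 n, one_pow]

theorem hasSum_traceForm_apply (hlam : Summable fun n => |lam n|) (A B : U →L[ℝ] H) :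
    HasSum (fun n => lam n * ⟪A (e n), B (e n)⟫) (traceForm H e lam A B) :=
  (hasSum_traceForm hlam).mapL ((ContinuousLinearMap.apply ℝ ℝ B) ∘L
    (ContinuousLinearMap.apply ℝ ((U →L[ℝ] H) →L[ℝ] ℝ) A))

variable [CompleteSpace U] [CompleteSpace H]

theorem hasSum_comp_covOp_comp_adjoint (hlam : Summable fun n => |lam n|) (A B : U →L[ℝ] H)
    (x : H) :
    HasSum (fun n => ⟪A (e n), x⟫ • (lam n • B (e n))) ((B ∘L covOp e lam ∘L A†) x) := by
  refine ((hasSum_covOp e lam hlam ((A†) x)).mapL B).congr_fun fun n => ?_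
  rw [map_smul, smul_smul, ContinuousLinearMap.adjoint_inner_left, real_inner_comm, mul_comm]

theorem inner_comp_covOp_comp_adjoint (hlam : Summable fun n => |lam n|) (A B : U →L[ℝ] H)
    (x y : H) :
    ⟪(B ∘L covOp e lam ∘L A†) x, y⟫ =
      traceForm ℝ e lam (innerSL ℝ x ∘L A) (innerSL ℝ y ∘L B) := by
  have h := (hasSum_comp_covOp_comp_adjoint (e := e) hlam A B x).mapL (innerSL ℝ y)
  rw [real_inner_comm]
  refine h.unique ((hasSum_traceForm_apply hlam _ _).congr_fun fun n => ?_)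
  simp only [innerSL_apply_apply, real_inner_smul_right, ContinuousLinearMap.comp_apply,
    RCLike.inner_apply, conj_trivial, real_inner_comm x]
  ring

omit [CompleteSpace U] [CompleteSpace H] in
theorem summable_norm_mul_norm (hlam : Summable fun n => |lam n|) (A B : U →L[ℝ] H) :
    Summable fun n => ‖A (e n)‖ * ‖lam n • B (e n)‖ := by
  have hle : ∀ (A : U →L[ℝ] H) n, ‖A (e n)‖ ≤ ‖A‖ := fun A n => by
    simpa only [e.orthonormal.1 n, mul_one] using A.le_opNorm (e n)
  refine .of_nonneg_of_le (fun n => by positivity) (fun n => ?_) (hlam.mul_left (‖A‖ * ‖B‖))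
  calc ‖A (e n)‖ * ‖lam n • B (e n)‖ = ‖A (e n)‖ * (|lam n| * ‖B (e n)‖) := by
        rw [norm_smul, Real.norm_eq_abs]
    _ ≤ ‖A‖ * (|lam n| * ‖B‖) := by gcongr <;> exact hle _ n
    _ = ‖A‖ * ‖B‖ * |lam n| := by ring

theorem isTraceClass_comp_covOp_comp_adjoint (hlam : Summable fun n => |lam n|) (A B : U →L[ℝ] H) :
    IsTraceClass (B ∘L covOp e lam ∘L A†) :=
  ⟨_, _, summable_norm_mul_norm hlam A B, hasSum_comp_covOp_comp_adjoint hlam A B⟩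

theorem trace_comp_covOp_comp_adjoint (hlam : Summable fun n => |lam n|) (A B : U →L[ℝ] H)
    {ι : Type*} (b : HilbertBasis ι ℝ H) :
    trace b (B ∘L covOp e lam ∘L A†) = traceForm H e lam A B := by
  rw [trace_eq_tsum_inner b (summable_norm_mul_norm hlam A B)
    (hasSum_comp_covOp_comp_adjoint hlam A B), ← (hasSum_traceForm_apply hlam A B).tsum_eq]
  simp only [real_inner_smul_right]

end TraceForm

section Series

theorem hasSum_inner_of_orthogonal {ι F : Type*} [NormedAddCommGroup F] [InnerProductSpace ℝ F]
    {x y : ι → F} {a b : F} (hx : HasSum x a) (hy : HasSum y b)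
    (horth : ∀ n m, n ≠ m → ⟪x n, y m⟫ = 0) : HasSum (fun n => ⟪x n, y n⟫) ⟪a, b⟫ := by
  have hdiag : ∀ n, ⟪x n, b⟫ = ⟪x n, y n⟫ := fun n =>
    (hy.mapL (innerSL ℝ (x n))).unique (hasSum_single n fun m hm => horth n m hm.symm)
  rw [real_inner_comm b a]
  refine (hx.mapL (innerSL ℝ b)).congr_fun fun n => ?_
  rw [innerSL_apply_apply, real_inner_comm (x n) b, hdiag, real_inner_comm]

theorem summable_abs_of_summable_sqrt {ι : Type*} {lam : ι → ℝ} (hlam0 : ∀ n, 0 ≤ lam n)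
    (hlam : Summable fun n => √(lam n)) : Summable fun n => |lam n| := by
  refine (hlam.norm.mul_tendsto_const hlam.tendsto_cofinite_zero).congr fun n => ?_
  rw [Real.mul_self_sqrt (hlam0 n), abs_of_nonneg (hlam0 n)]

end Series

section NoiseIntegral

variable {Ω : Type*} [MeasurableSpace Ω] {P : Measure Ω} {T : ℝ} {φ : ℝ → ℝ → ℝ} {p : ℝ≥0∞}
  {g : ℕ → Icc (0 : ℝ) T → Ω → ℝ}

/-- The processes `g 0, g 1, …` all have second moments `R`, and are mutually orthogonal in
`L²(Ω)`: the second order structure of independent centred processes with covariance `R`. -/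
structure IsOrthogonalNoise (P : Measure Ω) (φ : ℝ → ℝ → ℝ) (g : ℕ → Icc (0 : ℝ) T → Ω → ℝ) :
    Prop where
  hasKernelCov : ∀ n, HasKernelCov P φ (g n)
  integral_mul_eq_zero : ∀ n m, n ≠ m → ∀ t s, ∫ ω, g n t ω * g m s ω ∂P = 0

theorem isOrthogonalNoise_of_gaussian [IsProbabilityMeasure P]
    (hgauss : ∀ n, IsGaussianProcess (g n) P) (hmean : ∀ n t, ∫ ω, g n t ω ∂P = 0)
    (hcov : ∀ n t s, covariance (g n t) (g n s) P = kernelCov φ t s)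
    (hindep : iIndepFun (fun n ω t => g n t ω) P) : IsOrthogonalNoise P φ g := by
  have hL2 : ∀ n t, MemLp (g n t) 2 P := fun n t => ((hgauss n).hasGaussianLaw_eval t).memLp_two
  have hmul : ∀ n m t s, ∫ ω, g n t ω * g m s ω ∂P = covariance (g n t) (g m s) P :=
    fun n m t s => by
      rw [covariance_eq_sub (hL2 n t) (hL2 m s), hmean, zero_mul, sub_zero]
      rfl
  refine ⟨fun n => ⟨hL2 n, fun t s => (hmul n n t s).trans (hcov n t s)⟩, fun n m hnm t s => ?_⟩
  have hind : IndepFun (g n t) (g m s) P :=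
    (hindep.indepFun hnm).comp (measurable_pi_apply t) (measurable_pi_apply s)
  exact (hmul n m t s).trans (hind.covariance_eq_zero (hL2 n t) (hL2 m s))

variable [Fact (1 ≤ p)] {U : Type*} [NormedAddCommGroup U] [InnerProductSpace ℝ U]
  {H H' : Type*} [NormedAddCommGroup H] [InnerProductSpace ℝ H]
  [NormedAddCommGroup H'] [InnerProductSpace ℝ H']

/-- The operator `f ↦ √λ_n ∫_0^T f(s) e_n dg_n(s)` on `L^p([0,T]; L(U, H))`. -/
def noiseTermL (P : Measure Ω) (p : ℝ≥0∞) [Fact (1 ≤ p)] (g : ℕ → Icc (0 : ℝ) T → Ω → ℝ)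
    (e : HilbertBasis ℕ ℝ U) (lam : ℕ → ℝ) (n : ℕ) :
    Lp (U →L[ℝ] H) p (timeMeasure T) →L[ℝ] Lp H 2 P :=
  √(lam n) • (wienerIntegralL P p (g n) ∘L
    (ContinuousLinearMap.apply ℝ H (e n)).compLpL p (timeMeasure T))

/-- The operator `f ↦ ∫_0^T f dG` from `L^p([0,T]; L(U, H))` to `L²(Ω; H)`. -/
def noiseIntegralL (P : Measure Ω) (p : ℝ≥0∞) [Fact (1 ≤ p)] (g : ℕ → Icc (0 : ℝ) T → Ω → ℝ)
    (e : HilbertBasis ℕ ℝ U) (lam : ℕ → ℝ) :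
    Lp (U →L[ℝ] H) p (timeMeasure T) →L[ℝ] Lp H 2 P :=
  ∑' n, noiseTermL P p g e lam n

variable {e : HilbertBasis ℕ ℝ U} {lam : ℕ → ℝ}

theorem noiseTermL_apply (n : ℕ) (f : Lp (U →L[ℝ] H) p (timeMeasure T)) :
    noiseTermL P p g e lam n f = √(lam n) • wienerIntegralL P p (g n)
      ((ContinuousLinearMap.apply ℝ H (e n)).compLpL p (timeMeasure T) f) := rfl

variable [hp : Fact (p ≠ ∞)] [CompleteSpace H] [CompleteSpace H']

theorem norm_noiseTermL_le {C : ℝ≥0} (hφ : KernelCondition T φ p)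
    (hC : IsBoundedKernel (timeMeasure T) φ p C) {n : ℕ} (hg : HasKernelCov P φ (g n)) :
    ‖(noiseTermL P p g e lam n : Lp (U →L[ℝ] H) p (timeMeasure T) →L[ℝ] Lp H 2 P)‖ ≤
      √(lam n) * √(4 * C) := by
  have hI : ‖(wienerIntegralL P p (g n) : Lp H p (timeMeasure T) →L[ℝ] Lp H 2 P)‖ ≤ √(4 * C) :=
    (isWienerIntegral_wienerIntegralL hφ hg).norm_le hφ hC hg
  have heval : ‖(ContinuousLinearMap.apply ℝ H (e n)).compLpL p (timeMeasure T)‖ ≤ 1 := by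
    refine (ContinuousLinearMap.norm_compLpL_le _).trans
      (ContinuousLinearMap.opNorm_le_bound _ zero_le_one fun A => ?_)
    simpa only [e.orthonormal.1 n, mul_one, one_mul, ContinuousLinearMap.apply_apply]
      using A.le_opNorm (e n)
  rw [noiseTermL, norm_smul, Real.norm_of_nonneg (Real.sqrt_nonneg _)]
  gcongr
  calc _ ≤ √(4 * C) * 1 := (ContinuousLinearMap.opNorm_comp_le _ _).trans (by gcongr)
    _ = √(4 * C) := mul_one _

theorem hasSum_noiseIntegralL (hφ : KernelCondition T φ p) (hg : ∀ n, HasKernelCov P φ (g n))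
    (hlam : Summable fun n => √(lam n)) :
    HasSum (noiseTermL P p g e lam)
      (noiseIntegralL P p g e lam : Lp (U →L[ℝ] H) p (timeMeasure T) →L[ℝ] Lp H 2 P) := by
  obtain ⟨C, hC⟩ := hφ.exists_isBoundedKernel
  exact (Summable.of_norm_bounded (hlam.mul_right _) fun n =>
    norm_noiseTermL_le hφ hC (hg n)).hasSum

theorem hasSum_noiseIntegralL_apply (hφ : KernelCondition T φ p)
    (hg : ∀ n, HasKernelCov P φ (g n)) (hlam : Summable fun n => √(lam n))
    (f : Lp (U →L[ℝ] H) p (timeMeasure T)) :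
    HasSum (fun n => noiseTermL P p g e lam n f) (noiseIntegralL P p g e lam f) :=
  (hasSum_noiseIntegralL hφ hg hlam).mapL (ContinuousLinearMap.apply ℝ (Lp H 2 P) f)

theorem compLpL_noiseIntegralL (hφ : KernelCondition T φ p) (hg : ∀ n, HasKernelCov P φ (g n))
    (hlam : Summable fun n => √(lam n)) (L : H →L[ℝ] H')
    (f : Lp (U →L[ℝ] H) p (timeMeasure T)) :
    L.compLpL 2 P (noiseIntegralL P p g e lam f) = noiseIntegralL P p g e lam
      ((ContinuousLinearMap.compL ℝ U H H' L).compLpL p (timeMeasure T) f) := by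
  refine ((hasSum_noiseIntegralL_apply hφ hg hlam f).mapL (L.compLpL 2 P)).unique
    ((hasSum_noiseIntegralL_apply hφ hg hlam _).congr_fun fun n => ?_)
  rw [noiseTermL_apply, noiseTermL_apply, map_smul,
    (isWienerIntegral_wienerIntegralL hφ (hg n)).compLpL_apply (hg n)
      (isWienerIntegral_wienerIntegralL hφ (hg n)), compLpL_compLpL, compLpL_compLpL]
  rfl

theorem inner_noiseTermL (hφ : KernelCondition T φ p) {n : ℕ} (hg : HasKernelCov P φ (g n))
    (hlam : 0 ≤ lam n) (f k : Lp (U →L[ℝ] H) p (timeMeasure T)) :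
    ⟪noiseTermL P p g e lam n f, noiseTermL P p g e lam n k⟫ =
      ∫ z, (lam n • evalForm H (e n)) (f z.1) (k z.2) * φ z.1 z.2
        ∂(timeMeasure T).prod (timeMeasure T) := by
  let ev := ContinuousLinearMap.apply ℝ H (e n)
  have hae : kernelForm (timeMeasure T) φ (ev.compLpL p (timeMeasure T) f)
      (ev.compLpL p (timeMeasure T) k) =
      kernelForm (timeMeasure T) φ (fun s => f s (e n)) (fun s => k s (e n)) :=
    kernelForm_congr (ev.coeFn_compLpL f) (ev.coeFn_compLpL k)
  rw [noiseTermL_apply, noiseTermL_apply, real_inner_smul_left, real_inner_smul_right, ← mul_assoc,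
    Real.mul_self_sqrt hlam, (isWienerIntegral_wienerIntegralL hφ hg).inner_eq hφ hg, hae,
    kernelForm, ← integral_const_mul]
  simp only [_root_.smul_apply, evalForm_apply, smul_eq_mul, mul_assoc]

theorem inner_noiseTermL_of_ne (hφ : KernelCondition T φ p) (hg : IsOrthogonalNoise P φ g)
    {n m : ℕ} (hnm : n ≠ m) (f k : Lp (U →L[ℝ] H) p (timeMeasure T)) :
    ⟪noiseTermL P p g e lam n f, noiseTermL P p g e lam m k⟫ = 0 := by
  have h := IsWienerIntegral.inner_eq_zero (H := H) (hg.hasKernelCov n) (hg.hasKernelCov m)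
    (hg.integral_mul_eq_zero n m hnm) (isWienerIntegral_wienerIntegralL hφ (hg.hasKernelCov n))
    (isWienerIntegral_wienerIntegralL hφ (hg.hasKernelCov m))
  rw [noiseTermL_apply, noiseTermL_apply, real_inner_smul_left, real_inner_smul_right, h, mul_zero,
    mul_zero]

theorem inner_noiseIntegralL (hφ : KernelCondition T φ p) (hg : IsOrthogonalNoise P φ g)
    (hlam0 : ∀ n, 0 ≤ lam n) (hlam : Summable fun n => √(lam n))
    (f k : Lp (U →L[ℝ] H) p (timeMeasure T)) :
    ⟪noiseIntegralL P p g e lam f, noiseIntegralL P p g e lam k⟫ =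
      ∫ z, traceForm H e lam (f z.1) (k z.2) * φ z.1 z.2
        ∂(timeMeasure T).prod (timeMeasure T) := by
  obtain ⟨C, hC⟩ := hφ.exists_isBoundedKernel
  have hinner := hasSum_inner_of_orthogonal
    (hasSum_noiseIntegralL_apply (e := e) hφ hg.hasKernelCov hlam f)
    (hasSum_noiseIntegralL_apply hφ hg.hasKernelCov hlam k)
    fun n m hnm => inner_noiseTermL_of_ne hφ hg hnm f k
  have htrace := hC.hasSum_integral_apply₂ Fact.out
    (hasSum_traceForm (H := H) (e := e) (summable_abs_of_summable_sqrt hlam0 hlam))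
    (Lp.memLp f) (Lp.memLp k)
  exact hinner.unique <| htrace.congr_fun fun n =>
    inner_noiseTermL hφ (hg.hasKernelCov n) (hlam0 n) f k

theorem noiseIntegralL_mem_weakSubmodule {G : Submodule ℝ (Lp ℝ 2 P)}
    (hG : IsClosed (G : Set (Lp ℝ 2 P))) (hφ : KernelCondition T φ p)
    (hg : ∀ n, HasKernelCov P φ (g n)) (hgG : ∀ n t, ((hg n).memLp t).toLp ∈ G)
    (hlam : Summable fun n => √(lam n)) (f : Lp (U →L[ℝ] H) p (timeMeasure T)) :
    noiseIntegralL P p g e lam f ∈ weakSubmodule H G := by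
  refine (isClosed_weakSubmodule hG).mem_of_tendsto (hasSum_noiseIntegralL_apply hφ hg hlam f)
    (.of_forall fun s => Submodule.sum_mem _ fun n _ => Submodule.smul_mem _ _ ?_)
  refine mem_weakSubmodule.2 fun L => ?_
  rw [ContinuousLinearMap.coe_coe, ContinuousLinearMap.comp_apply,
    (isWienerIntegral_wienerIntegralL hφ (hg n)).compLpL_apply (hg n)
      (isWienerIntegral_wienerIntegralL hφ (hg n))]
  exact (isWienerIntegral_wienerIntegralL hφ (hg n)).apply_mem (hg n) hG (hgG n) _

end NoiseIntegral

section Truncation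

variable {Ω : Type*} [MeasurableSpace Ω] {P : Measure Ω} {T : ℝ} {p : ℝ≥0∞}
  {E : Type*} [NormedAddCommGroup E] {h : ℝ → E}

/-- The class of `1_{(0,t]} h` in `L^p([0,T]; E)`. -/
def truncLp (hh : MemLp h p (timeMeasure T)) (t : ℝ) : Lp E p (timeMeasure T) :=
  (hh.indicator (measurableSet_Ioc : MeasurableSet (Ioc 0 t))).toLp

theorem truncLp_self (hh : MemLp h p (timeMeasure T)) : truncLp hh T = hh.toLp := by
  refine MemLp.toLp_congr _ _ ?_
  filter_upwards [ae_timeMeasure_mem_Ioc T] with s hs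
  exact indicator_of_mem hs h

variable [Fact (1 ≤ p)] {U H : Type*} [NormedAddCommGroup U] [InnerProductSpace ℝ U]
  [NormedAddCommGroup H] [InnerProductSpace ℝ H] (g : ℕ → Icc (0 : ℝ) T → Ω → ℝ)
  (e : HilbertBasis ℕ ℝ U) (lam : ℕ → ℝ) {h : ℝ → U →L[ℝ] H} (hh : MemLp h p (timeMeasure T))

theorem gaussianTerm_eq_noiseTermL (t : ℝ) (n : ℕ) :
    gaussianTerm P p g e lam h t n = noiseTermL P p g e lam n (truncLp hh t) := by
  have heval : (ContinuousLinearMap.apply ℝ H (e n)) ∘ (Ioc 0 t).indicator h =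
      (Ioc 0 t).indicator fun s => h s (e n) :=
    (indicator_comp_of_zero (map_zero (ContinuousLinearMap.apply ℝ H (e n)))).symm
  have hmem := (ContinuousLinearMap.apply ℝ H (e n)).comp_memLp'
    (hh.indicator (measurableSet_Ioc : MeasurableSet (Ioc 0 t)))
  rw [heval] at hmem
  rw [gaussianTerm, wienerIntegral, dif_pos hmem, noiseTermL_apply, truncLp, compLpL_toLp]
  simp only [heval]

variable {φ : ℝ → ℝ → ℝ} [Fact (p ≠ ∞)] [CompleteSpace H] (hφ : KernelCondition T φ p)
  (hg : ∀ n, HasKernelCov P φ (g n)) (hlam : Summable fun n => √(lam n)) (t : ℝ)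
include hφ hg hlam

theorem hasSum_gaussianTerm :
    HasSum (gaussianTerm P p g e lam h t) (noiseIntegralL P p g e lam (truncLp hh t)) := by
  rw [funext (gaussianTerm_eq_noiseTermL g e lam hh t)]
  exact hasSum_noiseIntegralL_apply hφ hg hlam _

theorem gaussianIntegral_eq_noiseIntegralL :
    gaussianIntegral P p g e lam h t = noiseIntegralL P p g e lam (truncLp hh t) :=
  (hasSum_gaussianTerm g e lam hh hφ hg hlam t).tsum_eq

end Truncation

section Covariance

theorem intervalIntegral_eq_integral_prod {T : ℝ} (hT : 0 ≤ T) {F : ℝ × ℝ → ℝ}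
    (hF : Integrable F ((timeMeasure T).prod (timeMeasure T))) :
    ∫ s' in (0 : ℝ)..T, ∫ s in (0 : ℝ)..T, F (s, s') =
      ∫ z, F z ∂(timeMeasure T).prod (timeMeasure T) := by
  simp only [intervalIntegral.integral_of_le hT, ← integral_Icc_eq_integral_Ioc]
  exact (integral_prod_symm F hF).symm

variable {Ω : Type*} [MeasurableSpace Ω] {P : Measure Ω} {T : ℝ} {φ : ℝ → ℝ → ℝ} {p : ℝ≥0∞}
  {g : ℕ → Icc (0 : ℝ) T → Ω → ℝ} [Fact (1 ≤ p)]
  {U : Type*} [NormedAddCommGroup U] [InnerProductSpace ℝ U]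
  {H : Type*} [NormedAddCommGroup H] [InnerProductSpace ℝ H] [CompleteSpace H]
  {e : HilbertBasis ℕ ℝ U} {lam : ℕ → ℝ}

theorem integrable_inner_comp_covOp_comp_adjoint [CompleteSpace U] {h₁ h₂ : ℝ → U →L[ℝ] H}
    (hφ : KernelCondition T φ p) (hlam : Summable fun n => |lam n|)
    (h₁_mem : MemLp h₁ p (timeMeasure T)) (h₂_mem : MemLp h₂ p (timeMeasure T)) (x y : H) :
    Integrable (fun z : ℝ × ℝ => ⟪(h₂ z.2 ∘L covOp e lam ∘L (h₁ z.1)†) x, y⟫ * φ z.1 z.2)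
      ((timeMeasure T).prod (timeMeasure T)) := by
  obtain ⟨C, hC⟩ := hφ.exists_isBoundedKernel
  simp only [inner_comp_covOp_comp_adjoint hlam]
  exact hC.integrable_apply₂ Fact.out (traceForm ℝ e lam)
    ((ContinuousLinearMap.compL ℝ U H ℝ (innerSL ℝ x)).comp_memLp' h₁_mem)
    ((ContinuousLinearMap.compL ℝ U H ℝ (innerSL ℝ y)).comp_memLp' h₂_mem)

theorem integrable_trace_comp_covOp_comp_adjoint [CompleteSpace U] {h₁ h₂ : ℝ → U →L[ℝ] H}
    (hφ : KernelCondition T φ p) (hlam : Summable fun n => |lam n|)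
    (h₁_mem : MemLp h₁ p (timeMeasure T)) (h₂_mem : MemLp h₂ p (timeMeasure T)) {ι : Type*}
    (b : HilbertBasis ι ℝ H) :
    Integrable (fun z : ℝ × ℝ => trace b (h₂ z.2 ∘L covOp e lam ∘L (h₁ z.1)†) * φ z.1 z.2)
      ((timeMeasure T).prod (timeMeasure T)) := by
  obtain ⟨C, hC⟩ := hφ.exists_isBoundedKernel
  simp only [trace_comp_covOp_comp_adjoint hlam]
  exact hC.integrable_apply₂ Fact.out (traceForm H e lam) h₁_mem h₂_mem

variable [Fact (p ≠ ∞)]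

theorem integral_inner_noiseIntegralL_toLp (hφ : KernelCondition T φ p)
    (hg : IsOrthogonalNoise P φ g) (hlam0 : ∀ n, 0 ≤ lam n) (hlam : Summable fun n => √(lam n))
    {h k : ℝ → U →L[ℝ] H} (hh : MemLp h p (timeMeasure T)) (hk : MemLp k p (timeMeasure T)) :
    ∫ ω, ⟪noiseIntegralL P p g e lam hh.toLp ω, noiseIntegralL P p g e lam hk.toLp ω⟫ ∂P =
      ∫ z, traceForm H e lam (h z.1) (k z.2) * φ z.1 z.2
        ∂(timeMeasure T).prod (timeMeasure T) := by
  rw [← L2.inner_def, inner_noiseIntegralL hφ hg hlam0 hlam]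
  refine integral_congr_ae ?_
  filter_upwards [Measure.quasiMeasurePreserving_fst.ae hh.coeFn_toLp,
    Measure.quasiMeasurePreserving_snd.ae hk.coeFn_toLp] with z h1 h2
  rw [h1, h2]

theorem inner_noiseIntegralL_toLp_ae_eq (hφ : KernelCondition T φ p)
    (hg : ∀ n, HasKernelCov P φ (g n)) (hlam : Summable fun n => √(lam n)) {h : ℝ → U →L[ℝ] H}
    (hh : MemLp h p (timeMeasure T)) (x : H) :
    (fun ω => ⟪noiseIntegralL P p g e lam hh.toLp ω, x⟫) =ᵐ[P] noiseIntegralL P p g e lam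
      ((ContinuousLinearMap.compL ℝ U H ℝ (innerSL ℝ x)).comp_memLp' hh).toLp := by
  rw [← compLpL_toLp _ hh, ← compLpL_noiseIntegralL hφ hg hlam (innerSL ℝ x)]
  filter_upwards [(innerSL ℝ x).coeFn_compLpL (noiseIntegralL P p g e lam hh.toLp)] with ω hω
  rw [hω, innerSL_apply_apply, real_inner_comm]

theorem integral_inner_mul_inner_noiseIntegralL_toLp (hφ : KernelCondition T φ p)
    (hg : IsOrthogonalNoise P φ g) (hlam0 : ∀ n, 0 ≤ lam n) (hlam : Summable fun n => √(lam n))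
    {h k : ℝ → U →L[ℝ] H} (hh : MemLp h p (timeMeasure T)) (hk : MemLp k p (timeMeasure T))
    (x y : H) :
    ∫ ω, ⟪noiseIntegralL P p g e lam hh.toLp ω, x⟫ *
        ⟪noiseIntegralL P p g e lam hk.toLp ω, y⟫ ∂P =
      ∫ z, traceForm ℝ e lam (innerSL ℝ x ∘L h z.1) (innerSL ℝ y ∘L k z.2) * φ z.1 z.2
        ∂(timeMeasure T).prod (timeMeasure T) := by
  have hx := inner_noiseIntegralL_toLp_ae_eq (e := e) hφ hg.hasKernelCov hlam hh x
  have hy := inner_noiseIntegralL_toLp_ae_eq (e := e) hφ hg.hasKernelCov hlam hk y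
  refine (integral_congr_ae ?_).trans (integral_inner_noiseIntegralL_toLp hφ hg hlam0 hlam
    ((ContinuousLinearMap.compL ℝ U H ℝ (innerSL ℝ x)).comp_memLp' hh)
    ((ContinuousLinearMap.compL ℝ U H ℝ (innerSL ℝ y)).comp_memLp' hk))
  filter_upwards [hx, hy] with ω hxω hyω
  rw [hxω, hyω, RCLike.inner_apply, conj_trivial, mul_comm]

variable [CompleteSpace U] {h₁ h₂ : ℝ → U →L[ℝ] H}

theorem integral_inner_mul_inner_gaussianIntegral (hT : 0 ≤ T) (hφ : KernelCondition T φ p)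
    (hg : IsOrthogonalNoise P φ g) (hlam0 : ∀ n, 0 ≤ lam n) (hlam : Summable fun n => √(lam n))
    (h₁_mem : MemLp h₁ p (timeMeasure T)) (h₂_mem : MemLp h₂ p (timeMeasure T)) (x y : H) :
    ∫ ω, ⟪gaussianIntegral P p g e lam h₁ T ω, x⟫ *
        ⟪gaussianIntegral P p g e lam h₂ T ω, y⟫ ∂P =
      ∫ s' in (0 : ℝ)..T, ∫ s in (0 : ℝ)..T,
        ⟪(h₂ s' ∘L covOp e lam ∘L (h₁ s)†) x, y⟫ * φ s s' := by
  have hlam1 := summable_abs_of_summable_sqrt hlam0 hlam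
  rw [gaussianIntegral_eq_noiseIntegralL g e lam h₁_mem hφ hg.hasKernelCov hlam,
    gaussianIntegral_eq_noiseIntegralL g e lam h₂_mem hφ hg.hasKernelCov hlam, truncLp_self,
    truncLp_self, integral_inner_mul_inner_noiseIntegralL_toLp hφ hg hlam0 hlam,
    intervalIntegral_eq_integral_prod hT
      (integrable_inner_comp_covOp_comp_adjoint hφ hlam1 h₁_mem h₂_mem x y)]
  simp only [inner_comp_covOp_comp_adjoint hlam1]

theorem integral_inner_gaussianIntegral (hT : 0 ≤ T) (hφ : KernelCondition T φ p)
    (hg : IsOrthogonalNoise P φ g) (hlam0 : ∀ n, 0 ≤ lam n) (hlam : Summable fun n => √(lam n))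
    (h₁_mem : MemLp h₁ p (timeMeasure T)) (h₂_mem : MemLp h₂ p (timeMeasure T)) {ι : Type*}
    (b : HilbertBasis ι ℝ H) :
    ∫ ω, ⟪gaussianIntegral P p g e lam h₁ T ω, gaussianIntegral P p g e lam h₂ T ω⟫ ∂P =
      ∫ s' in (0 : ℝ)..T, ∫ s in (0 : ℝ)..T,
        trace b (h₂ s' ∘L covOp e lam ∘L (h₁ s)†) * φ s s' := by
  have hlam1 := summable_abs_of_summable_sqrt hlam0 hlam
  rw [gaussianIntegral_eq_noiseIntegralL g e lam h₁_mem hφ hg.hasKernelCov hlam,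
    gaussianIntegral_eq_noiseIntegralL g e lam h₂_mem hφ hg.hasKernelCov hlam, truncLp_self,
    truncLp_self, integral_inner_noiseIntegralL_toLp hφ hg hlam0 hlam,
    intervalIntegral_eq_integral_prod hT
      (integrable_trace_comp_covOp_comp_adjoint hφ hlam1 h₁_mem h₂_mem b)]
  simp only [trace_comp_covOp_comp_adjoint hlam1]

end Covariance

section Moments

variable {Ω : Type*} [MeasurableSpace Ω] {P : Measure Ω} {E : Type*} [NormedAddCommGroup E]
  [NormedSpace ℝ E] [CompleteSpace E]

-- The inclusion `W → L^q` has a closed graph, since limits in measure are unique.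
theorem exists_inclusion_of_forall_memLp {r q : ℝ≥0∞} [Fact (1 ≤ r)] [Fact (1 ≤ q)]
    {W : Submodule ℝ (Lp E r P)} (hW : IsClosed (W : Set (Lp E r P)))
    (hWq : ∀ X ∈ W, MemLp X q P) :
    ∃ J : W →L[ℝ] Lp E q P, ∀ X : W, J X =ᵐ[P] (X : Lp E r P) := by
  have : CompleteSpace W := hW.completeSpace_coe
  let J : W →ₗ[ℝ] Lp E q P :=
    { toFun := fun X => (hWq X X.2).toLp
      map_add' := fun X Y => (MemLp.toLp_eq_toLp_iff _ ((hWq X X.2).add (hWq Y Y.2))).2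
        (Lp.coeFn_add (X : Lp E r P) Y)
      map_smul' := fun a X => (MemLp.toLp_eq_toLp_iff _ ((hWq X X.2).const_smul a)).2
        (Lp.coeFn_smul a (X : Lp E r P)) }
  have hJ_coe : ∀ X : W, J X =ᵐ[P] (X : Lp E r P) := fun X => (hWq X X.2).coeFn_toLp
  refine ⟨⟨J, J.continuous_of_seq_closed_graph fun u X Y hu hJu => ?_⟩, hJ_coe⟩
  have hX : TendstoInMeasure P (fun n => (u n : Lp E r P)) Filter.atTop (X : Lp E r P) :=
    tendstoInMeasure_of_tendsto_Lp ((continuous_subtype_val.tendsto X).comp hu)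
  have hY : TendstoInMeasure P (fun n => (u n : Lp E r P)) Filter.atTop Y :=
    (tendstoInMeasure_of_tendsto_Lp hJu).congr_left fun n => hJ_coe (u n)
  exact Lp.ext ((tendstoInMeasure_ae_unique hY hX).trans (hJ_coe X).symm)

variable [MeasurableSpace E] [BorelSpace E] [SecondCountableTopology E]

theorem IsGaussianSpace.exists_inclusion {G : Submodule ℝ (Lp ℝ 2 P)} (hG : IsGaussianSpace G)
    (hG_closed : IsClosed (G : Set (Lp ℝ 2 P))) {q : ℝ≥0∞} [Fact (1 ≤ q)] (hq : q ≠ ∞) :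
    ∃ J : weakSubmodule E G →L[ℝ] Lp E q P, ∀ X, J X =ᵐ[P] (X : Lp E 2 P) :=
  exists_inclusion_of_forall_memLp (isClosed_weakSubmodule hG_closed) fun _ hX =>
    (hG.hasGaussianLaw hX).memLp hq

end Moments

section NetInterpolation

variable {α E : Type*} [PseudoMetricSpace α] [NormedAddCommGroup E] [NormedSpace ℝ E]

/-- The interpolation of the values of `x` at the points of the finite set `A`, with the weight of
`a ∈ A` at `t` proportional to `max 0 (r - dist t a)`. -/
def netInterp (A : Finset α) (r : ℝ) (x : α → E) (t : α) : E :=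
  A.centerMass (fun a => max 0 (r - dist t a)) x

/-- The largest distance between values of `x` at a point of `A` and at a point of `B` that are less
than `r` apart. -/
def netModulus (A B : Finset α) (r : ℝ) (x : α → E) : ℝ≥0 :=
  {z ∈ A ×ˢ B | dist z.1 z.2 < r}.sup fun z => ‖x z.1 - x z.2‖₊

variable {A B : Finset α} {r s : ℝ} {t : α} {x : α → E}

theorem sum_netInterp_weight_pos (ht : ∃ a ∈ A, dist t a < r) :
    0 < ∑ a ∈ A, max 0 (r - dist t a) := by
  obtain ⟨a, ha, hta⟩ := ht
  exact Finset.sum_pos' (fun b _ => le_max_left _ _) ⟨a, ha, lt_max_of_lt_right (sub_pos.2 hta)⟩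

theorem continuous_netInterp (hA : ∀ t, ∃ a ∈ A, dist t a < r) : Continuous (netInterp A r x) := by
  have hweight : ∀ a : α, Continuous fun t => max 0 (r - dist t a) := by fun_prop
  refine (Continuous.inv₀ ?_ fun t => (sum_netInterp_weight_pos (hA t)).ne').smul ?_
  · exact continuous_finsetSum _ fun a _ => hweight a
  · exact continuous_finsetSum _ fun a _ => (hweight a).smul continuous_const

theorem netInterp_mem (ht : ∃ a ∈ A, dist t a < r) {S : Set E} (hS : Convex ℝ S)
    (hx : ∀ a ∈ A, dist t a < r → x a ∈ S) : netInterp A r x t ∈ S := by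
  classical
  rw [netInterp, ← Finset.centerMass_filter_ne_zero]
  refine hS.centerMass_mem (fun a _ => le_max_left _ _) ?_ fun a ha => ?_
  · rw [Finset.sum_filter_ne_zero]
    exact sum_netInterp_weight_pos ht
  · obtain ⟨haA, ha⟩ := Finset.mem_filter.1 ha
    refine hx a haA (lt_of_not_ge fun hle => ha (max_eq_left (sub_nonpos.2 hle)))

theorem dist_netInterp_le (hA : ∃ a ∈ A, dist t a < r) (hB : ∃ b ∈ B, dist t b < s) :
    dist (netInterp A r x t) (netInterp B s x t) ≤ netModulus A B (r + s) x := by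
  refine Metric.mem_closedBall'.1 (netInterp_mem hB (convex_closedBall _ _) fun b hb htb => ?_)
  refine Metric.mem_closedBall'.1 (netInterp_mem hA (convex_closedBall _ _) fun a ha hta => ?_)
  have hab : dist a b < r + s := (dist_triangle_left a b t).trans_lt (add_lt_add hta htb)
  rw [Metric.mem_closedBall, dist_eq_norm]
  exact Finset.le_sup (f := fun z : α × α => ‖x z.1 - x z.2‖₊)
    (Finset.mem_filter.2 ⟨Finset.mk_mem_product ha hb, hab⟩)

theorem tendsto_netInterp {A : ℕ → Finset α} {r : ℕ → ℝ}
    (hA : ∀ n, ∃ a ∈ A n, dist t a < r n) (hr : Filter.Tendsto r Filter.atTop (nhds 0))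
    (hx : ContinuousAt x t) :
    Filter.Tendsto (fun n => netInterp (A n) (r n) x t) Filter.atTop (nhds (x t)) := by
  refine Metric.tendsto_nhds.2 fun ε hε => ?_
  obtain ⟨δ, hδ, hxδ⟩ := Metric.continuousAt_iff.1 hx ε hε
  filter_upwards [hr.eventually_lt_const hδ] with n hn
  exact netInterp_mem (hA n) (convex_ball _ _) fun a _ hta => hxδ (dist_comm t a ▸ hta.trans hn)

theorem exists_continuous_tendsto_netInterp [CompleteSpace E] {A : ℕ → Finset α} {r : ℕ → ℝ}
    (hA : ∀ n t, ∃ a ∈ A n, dist t a < r n)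
    (hsum : Summable fun n => netModulus (A n) (A (n + 1)) (r n + r (n + 1)) x) :
    ∃ y : α → E, Continuous y ∧
      ∀ t, Filter.Tendsto (fun n => netInterp (A n) (r n) x t) Filter.atTop (nhds (y t)) := by
  let d n : ℝ := netModulus (A n) (A (n + 1)) (r n + r (n + 1)) x
  have hd : Summable d := NNReal.summable_coe.2 hsum
  have hstep : ∀ t n, dist (netInterp (A n) (r n) x t) (netInterp (A (n + 1)) (r (n + 1)) x t) ≤
      d n := fun t n => dist_netInterp_le (hA n t) (hA (n + 1) t)
  choose y hy using fun t =>
    cauchySeq_tendsto_of_complete (cauchySeq_of_dist_le_of_summable d (hstep t) hd)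
  have hunif : TendstoUniformly (fun n => netInterp (A n) (r n) x) y Filter.atTop := by
    refine Metric.tendstoUniformly_iff.2 fun ε hε => ?_
    filter_upwards [(tendsto_sum_nat_add d).eventually_lt_const hε] with n hn t
    rw [dist_comm]
    refine (dist_le_tsum_of_dist_le_of_tendsto d (hstep t) hd (hy t) n).trans_lt ?_
    simpa only [add_comm n] using hn
  exact ⟨y, hunif.continuous (.of_forall fun n => continuous_netInterp (hA n)), hy⟩

end NetInterpolation

section ContinuousModification

variable {α : Type*} {Ω : Type*} [MeasurableSpace Ω] {P : Measure Ω} {E : Type*}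
  [NormedAddCommGroup E]

theorem exists_continuous_modification_of_ae_tendsto [TopologicalSpace α] [IsFiniteMeasure P]
    {X : α → Ω → E} {Z : ℕ → α → Ω → E} (hZ : ∀ n t, StronglyMeasurable (Z n t))
    (hZX : ∀ t, TendstoInMeasure P (fun n => Z n t) Filter.atTop (X t))
    (hlim : ∀ᵐ ω ∂P, ∃ y : α → E, Continuous y ∧
      ∀ t, Filter.Tendsto (fun n => Z n t ω) Filter.atTop (nhds (y t))) :
    ∃ Y : α → Ω → E, (∀ t, StronglyMeasurable (Y t)) ∧ (∀ t, Y t =ᵐ[P] X t) ∧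
      ∀ ω, Continuous fun t => Y t ω := by
  obtain ⟨N, hN_compl, hN, hN_null⟩ := exists_measurable_superset_of_null (ae_iff.1 hlim)
  have hgood : ∀ ω, ∃ y : α → E, Continuous y ∧
      ∀ t, Filter.Tendsto (fun n => Nᶜ.indicator (Z n t) ω) Filter.atTop (nhds (y t)) := by
    intro ω
    by_cases hω : ω ∈ N
    · refine ⟨0, continuous_zero, fun t => ?_⟩
      simp only [indicator_of_notMem (notMem_compl_iff.2 hω)]
      exact tendsto_const_nhds
    · simp only [indicator_of_mem (mem_compl hω)]
      exact not_not.1 fun h => hω (hN_compl h)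
  choose Y hY_cont hY using hgood
  refine ⟨fun t ω => Y ω t, fun t => ?_, fun t => ?_, hY_cont⟩
  · exact stronglyMeasurable_of_tendsto Filter.atTop
      (fun n => (hZ n t).indicator hN.compl) (tendsto_pi_nhds.2 fun ω => hY ω t)
  · refine tendstoInMeasure_ae_unique (tendstoInMeasure_of_tendsto_ae
      (fun n => (hZ n t).aestronglyMeasurable) ?_) (hZX t)
    filter_upwards [compl_mem_ae_iff.2 hN_null] with ω hω
    simpa only [indicator_of_mem hω] using hY ω t

theorem finset_sup_rpow_le_sum {ι : Type*} (s : Finset ι) (f : ι → ℝ≥0∞) {q : ℝ} (hq : 0 < q) :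
    s.sup f ^ q ≤ ∑ i ∈ s, f i ^ q := by
  obtain rfl | hs := s.eq_empty_or_nonempty
  · simp [hq]
  · obtain ⟨i, hi, hmax⟩ := s.exists_mem_eq_sup hs f
    rw [hmax]
    exact Finset.single_le_sum (f := fun i => f i ^ q) (fun _ _ => zero_le) hi

theorem lintegral_finset_sup_le [IsProbabilityMeasure P] {ι : Type*} (s : Finset ι)
    {f : ι → Ω → ℝ≥0∞} (hf : ∀ i ∈ s, AEMeasurable (f i) P) {q : ℝ≥0} (hq : 1 ≤ q) {B : ℝ≥0∞}
    (hB : ∀ i ∈ s, eLpNorm (f i) q P ≤ B) :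
    ∫⁻ ω, s.sup (fun i => f i ω) ∂P ≤ (s.card : ℝ≥0∞) ^ (1 / q : ℝ) * B := by
  have hq0 : 0 < (q : ℝ) := zero_lt_one.trans_le hq
  have hq0' : q ≠ 0 := (zero_lt_one.trans_le hq).ne'
  let g : Ω → ℝ≥0∞ := fun ω => s.sup fun i => f i ω
  have hg : AEMeasurable g P := by
    simp only [g, Finset.sup_eq_iSup]
    exact .biSup _ s.countable_toSet hf
  have hg_norm : eLpNorm g q P ^ (q : ℝ) ≤ s.card * B ^ (q : ℝ) := by
    calc eLpNorm g q P ^ (q : ℝ)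
        = ∫⁻ ω, g ω ^ (q : ℝ) ∂P := eLpNorm_nnreal_pow_eq_lintegral hq0'
      _ ≤ ∫⁻ ω, ∑ i ∈ s, f i ω ^ (q : ℝ) ∂P :=
          lintegral_mono fun _ => finset_sup_rpow_le_sum s _ hq0
      _ = ∑ i ∈ s, eLpNorm (f i) q P ^ (q : ℝ) := by
          rw [lintegral_finsetSum' _ fun i hi => (hf i hi).pow_const _]
          simp only [eLpNorm_nnreal_pow_eq_lintegral hq0', enorm_eq_self]
      _ ≤ ∑ _i ∈ s, B ^ (q : ℝ) :=
          Finset.sum_le_sum fun i hi => ENNReal.rpow_le_rpow (hB i hi) hq0.le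
      _ = s.card * B ^ (q : ℝ) := by rw [Finset.sum_const, nsmul_eq_mul]
  calc ∫⁻ ω, g ω ∂P = eLpNorm g 1 P := by
        simp only [eLpNorm_one_eq_lintegral_enorm, enorm_eq_self]
    _ ≤ eLpNorm g q P :=
        eLpNorm_le_eLpNorm_of_exponent_le (mod_cast hq) hg.aestronglyMeasurable
    _ = (eLpNorm g q P ^ (q : ℝ)) ^ (1 / q : ℝ) := by
        rw [one_div, ENNReal.rpow_rpow_inv hq0.ne']
    _ ≤ (s.card * B ^ (q : ℝ)) ^ (1 / q : ℝ) := ENNReal.rpow_le_rpow hg_norm (by positivity)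
    _ = (s.card : ℝ≥0∞) ^ (1 / q : ℝ) * B := by
        rw [ENNReal.mul_rpow_of_nonneg _ _ (by positivity), one_div, ENNReal.rpow_rpow_inv hq0.ne']

theorem lintegral_netModulus_le [PseudoMetricSpace α] [IsProbabilityMeasure P] {q K δ : ℝ≥0}
    [hq : Fact (1 ≤ (q : ℝ≥0∞))] {X : α → Lp E q P} (hX : HolderWith K δ X) (A B : Finset α)
    (r : ℝ) :
    ∫⁻ ω, netModulus A B r (fun a => X a ω) ∂P ≤
      (A.card * B.card : ℝ≥0∞) ^ (1 / q : ℝ) * (K * ENNReal.ofReal r ^ (δ : ℝ)) := by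
  simp only [netModulus, ENNReal.coe_finset_sup, ← enorm_eq_nnnorm]
  refine (lintegral_finset_sup_le (B := K * ENNReal.ofReal r ^ (δ : ℝ)) _ (fun z _ => ?_)
    (mod_cast hq.out) fun z hz => ?_).trans ?_
  · exact ((Lp.aestronglyMeasurable _).sub (Lp.aestronglyMeasurable _)).enorm
  · calc eLpNorm (fun ω => ‖X z.1 ω - X z.2 ω‖ₑ) q P
        = edist (X z.1) (X z.2) := by rw [eLpNorm_enorm, Lp.edist_def]; rfl
      _ ≤ K * edist z.1 z.2 ^ (δ : ℝ) := hX z.1 z.2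
      _ ≤ K * ENNReal.ofReal r ^ (δ : ℝ) := by
          rw [edist_dist]
          gcongr
          exact (Finset.mem_filter.1 hz).2.le
  · gcongr
    exact_mod_cast (Finset.card_filter_le _ _).trans (Finset.card_product A B).le

end ContinuousModification

section KolmogorovContinuity

variable {α : Type*} [PseudoMetricSpace α] {Ω : Type*} [MeasurableSpace Ω] {P : Measure Ω}
  {E : Type*} [NormedAddCommGroup E] [NormedSpace ℝ E]

theorem coeFn_netInterp {q : ℝ≥0∞} [Fact (1 ≤ q)] (A : Finset α) (r : ℝ) (X : α → Lp E q P)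
    (t : α) :
    (netInterp A r X t : Lp E q P) =ᵐ[P] fun ω => netInterp A r (fun a => X a ω) t := by
  have hsmul : ∀ a ∈ A, ∀ᵐ ω ∂P,
      (max 0 (r - dist t a) • X a : Lp E q P) ω = max 0 (r - dist t a) • X a ω :=
    fun a _ => Lp.coeFn_smul _ _
  simp only [netInterp, Finset.centerMass]
  filter_upwards [Lp.coeFn_smul (∑ a ∈ A, max 0 (r - dist t a))⁻¹
      (∑ a ∈ A, max 0 (r - dist t a) • X a),
    Lp.coeFn_finsetSum A fun a => max 0 (r - dist t a) • X a,
    (Filter.eventually_all_finset A).2 hsmul] with ω h_smul h_sum h_terms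
  rw [h_smul, Pi.smul_apply, h_sum, Finset.sum_apply, Finset.sum_congr rfl h_terms]

theorem stronglyMeasurable_netInterp (A : Finset α) (r : ℝ) {X : α → Ω → E}
    (hX : ∀ a, StronglyMeasurable (X a)) (t : α) :
    StronglyMeasurable fun ω => netInterp A r (fun a => X a ω) t :=
  (Finset.stronglyMeasurable_fun_sum A fun a _ => (hX a).const_smul _).const_smul _

theorem exists_continuous_modification_of_holderWith [CompleteSpace E] [IsProbabilityMeasure P]
    {q K δ : ℝ≥0} [Fact (1 ≤ (q : ℝ≥0∞))] {X : α → Lp E q P} (hX : HolderWith K δ X) (hδ : 0 < δ)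
    {A : ℕ → Finset α} {r : ℕ → ℝ} (hA : ∀ n t, ∃ a ∈ A n, dist t a < r n)
    (hr : Filter.Tendsto r Filter.atTop (nhds 0))
    (hsum : ∑' n, ((A n).card * (A (n + 1)).card : ℝ≥0∞) ^ (1 / q : ℝ) *
      (K * ENNReal.ofReal (r n + r (n + 1)) ^ (δ : ℝ)) ≠ ∞) :
    ∃ Y : α → Ω → E, (∀ t, StronglyMeasurable (Y t)) ∧ (∀ t, Y t =ᵐ[P] X t) ∧
      ∀ ω, Continuous fun t => Y t ω := by
  have hX_meas : ∀ t, StronglyMeasurable (X t) := fun t => Lp.stronglyMeasurable (X t)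
  let M n ω : ℝ≥0 := netModulus (A n) (A (n + 1)) (r n + r (n + 1)) fun t => X t ω
  have hM_meas : ∀ n, AEMeasurable (fun ω => (M n ω : ℝ≥0∞)) P := by
    intro n
    simp only [M, netModulus, ENNReal.coe_finset_sup, Finset.sup_eq_iSup]
    exact .biSup _ (Finset.countable_toSet _) fun z _ =>
      ((hX_meas z.1).sub (hX_meas z.2)).enorm.aemeasurable
  have hM_lintegral : ∫⁻ ω, ∑' n, (M n ω : ℝ≥0∞) ∂P ≠ ∞ := by
    rw [lintegral_tsum hM_meas]
    exact ne_top_of_le_ne_top hsum (ENNReal.tsum_le_tsum fun n => lintegral_netModulus_le hX _ _ _)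
  refine exists_continuous_modification_of_ae_tendsto
    (Z := fun n t ω => netInterp (A n) (r n) (fun a => X a ω) t)
    (fun n t => stronglyMeasurable_netInterp _ _ hX_meas t) (fun t => ?_) ?_
  · exact (tendstoInMeasure_of_tendsto_Lp (tendsto_netInterp (fun n => hA n t) hr
      (hX.continuous hδ).continuousAt)).congr_left fun n => coeFn_netInterp _ _ _ _
  · filter_upwards [ae_lt_top' (.tsum hM_meas) hM_lintegral] with ω hω
    exact exists_continuous_tendsto_netInterp hA (ENNReal.tsum_coe_ne_top_iff_summable.1 hω.ne)

end KolmogorovContinuity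

section CompactInterval

variable {T : ℝ}

theorem exists_net_Icc (hT : 0 < T) (n : ℕ) :
    ∃ A : Finset (Icc (0 : ℝ) T), A.card ≤ 2 ^ (n + 1) ∧
      ∀ t, ∃ a ∈ A, dist t a < 2 * T * (1 / 2) ^ n := by
  classical
  have hstep : 0 < T / 2 ^ n := by positivity
  refine ⟨(Finset.range (2 ^ n + 1)).image fun j : ℕ => projIcc 0 T hT.le (j * (T / 2 ^ n)),
    ?_, fun t => ?_⟩
  · calc ((Finset.range (2 ^ n + 1)).image _).card
        ≤ 2 ^ n + 1 := Finset.card_image_le.trans_eq (Finset.card_range _)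
      _ ≤ 2 ^ (n + 1) := by rw [pow_succ, mul_two]; gcongr; exact Nat.one_le_two_pow
  · let j := ⌊(t : ℝ) / (T / 2 ^ n)⌋₊
    have hj_le : (j : ℝ) * (T / 2 ^ n) ≤ t :=
      (le_div_iff₀ hstep).1 (Nat.floor_le (div_nonneg t.2.1 hstep.le))
    have hj_lt : (t : ℝ) < (j + 1) * (T / 2 ^ n) :=
      (div_lt_iff₀ hstep).1 (Nat.lt_floor_add_one _)
    have hj_mem : (j : ℝ) * (T / 2 ^ n) ∈ Icc 0 T := ⟨by positivity, hj_le.trans t.2.2⟩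
    have hj : j ≤ 2 ^ n := by
      have : (j : ℝ) * (T / 2 ^ n) ≤ 2 ^ n * (T / 2 ^ n) :=
        hj_mem.2.trans_eq (mul_div_cancel₀ _ (by positivity)).symm
      exact_mod_cast le_of_mul_le_mul_right this hstep
    refine ⟨_, Finset.mem_image_of_mem _ (Finset.mem_range.2 (Nat.lt_succ_of_le hj)), ?_⟩
    rw [projIcc_of_mem _ hj_mem, Subtype.dist_eq, Real.dist_eq, abs_of_nonneg (sub_nonneg.2 hj_le)]
    calc (t : ℝ) - j * (T / 2 ^ n) < 2 * (T / 2 ^ n) := by linarith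
      _ = 2 * T * (1 / 2) ^ n := by rw [one_div_pow]; ring

theorem dyadic_rpow_mul_rpow_eq_geometric (q δ : ℝ≥0) (C : ℝ≥0∞) (c : ℝ) (n : ℕ) :
    ((2 : ℝ≥0∞) ^ (n + 1) * 2 ^ (n + 2)) ^ (1 / q : ℝ) *
        (C * ENNReal.ofReal (c * (1 / 2) ^ n) ^ (δ : ℝ)) =
      2 ^ (3 / q : ℝ) * (C * ENNReal.ofReal c ^ (δ : ℝ)) * (2 ^ (2 / q - δ : ℝ)) ^ n := by
  have hcard : ((2 : ℝ≥0∞) ^ (n + 1) * 2 ^ (n + 2)) ^ (1 / q : ℝ) =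
      2 ^ (3 / q : ℝ) * 2 ^ (2 / q * n : ℝ) := by
    rw [← pow_add, ← ENNReal.rpow_natCast, ← ENNReal.rpow_mul,
      ← ENNReal.rpow_add _ _ two_ne_zero ENNReal.ofNat_ne_top]
    congr 1
    push_cast
    ring
  have hdist : ENNReal.ofReal (c * (1 / 2) ^ n) ^ (δ : ℝ) =
      ENNReal.ofReal c ^ (δ : ℝ) * 2 ^ (-δ * n : ℝ) := by
    rw [ENNReal.ofReal_mul' (by positivity), ENNReal.mul_rpow_of_nonneg _ _ δ.coe_nonneg,
      ENNReal.ofReal_pow (by positivity), one_div, ENNReal.ofReal_inv_of_pos two_pos,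
      ENNReal.ofReal_ofNat, ← ENNReal.rpow_neg_one, ← ENNReal.rpow_natCast, ← ENNReal.rpow_mul,
      ← ENNReal.rpow_mul]
    congr 2
    ring
  have hpow : ((2 : ℝ≥0∞) ^ (2 / q - δ : ℝ)) ^ n = 2 ^ (2 / q * n : ℝ) * 2 ^ (-δ * n : ℝ) := by
    rw [← ENNReal.rpow_add _ _ two_ne_zero ENNReal.ofNat_ne_top, ← add_mul, ← sub_eq_add_neg,
      ENNReal.rpow_mul, ENNReal.rpow_natCast]
  rw [hcard, hdist, hpow]
  ring

theorem tsum_dyadic_ne_top {q δ : ℝ≥0} (hqδ : 2 < q * δ) {C : ℝ≥0∞} (hC : C ≠ ∞) (c : ℝ) :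
    ∑' n : ℕ, ((2 : ℝ≥0∞) ^ (n + 1) * 2 ^ (n + 2)) ^ (1 / q : ℝ) *
      (C * ENNReal.ofReal (c * (1 / 2) ^ n) ^ (δ : ℝ)) ≠ ∞ := by
  have hq : (0 : ℝ) < q := NNReal.coe_pos.2 (pos_of_ne_zero fun hq => by simp [hq] at hqδ)
  have hexp : 2 / (q : ℝ) - δ < 0 := by
    rw [sub_neg, div_lt_iff₀' hq]
    exact_mod_cast hqδ
  have hratio : (2 : ℝ≥0∞) ^ (2 / q - δ : ℝ) < 1 :=
    ENNReal.rpow_lt_one_of_one_lt_of_neg (by norm_num) hexp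
  simp only [dyadic_rpow_mul_rpow_eq_geometric]
  rw [ENNReal.tsum_mul_left, ENNReal.tsum_geometric]
  refine ENNReal.mul_ne_top (ENNReal.mul_ne_top ?_ (ENNReal.mul_ne_top hC ?_))
    (ENNReal.inv_ne_top.2 (tsub_pos_of_lt hratio).ne')
  · exact ENNReal.rpow_ne_top_of_nonneg (by positivity) ENNReal.ofNat_ne_top
  · exact ENNReal.rpow_ne_top_of_nonneg δ.coe_nonneg ENNReal.ofReal_ne_top

variable {Ω : Type*} [MeasurableSpace Ω] {P : Measure Ω} [IsProbabilityMeasure P]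
  {E : Type*} [NormedAddCommGroup E] [NormedSpace ℝ E] [CompleteSpace E]

theorem exists_continuous_modification_Icc (hT : 0 < T) {q K δ : ℝ≥0} [Fact (1 ≤ (q : ℝ≥0∞))]
    {X : Icc (0 : ℝ) T → Lp E q P} (hX : HolderWith K δ X) (hqδ : 2 < q * δ) :
    ∃ Y : Icc (0 : ℝ) T → Ω → E, (∀ t, StronglyMeasurable (Y t)) ∧ (∀ t, Y t =ᵐ[P] X t) ∧
      ∀ ω, Continuous fun t => Y t ω := by
  choose A hA_card hA using exists_net_Icc hT
  have hδ : 0 < δ := pos_of_ne_zero fun hδ => by simp [hδ] at hqδ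
  have hr : Filter.Tendsto (fun n : ℕ => 2 * T * (1 / 2 : ℝ) ^ n) Filter.atTop (nhds 0) := by
    simpa only [mul_zero] using
      (tendsto_pow_atTop_nhds_zero_of_lt_one (by norm_num) (by norm_num)).const_mul (2 * T)
  refine exists_continuous_modification_of_holderWith hX hδ hA hr
    (ne_top_of_le_ne_top (tsum_dyadic_ne_top hqδ (ENNReal.coe_ne_top (r := K)) (3 * T))
      (ENNReal.tsum_le_tsum fun n => ?_))
  have hr_add : 2 * T * (1 / 2 : ℝ) ^ n + 2 * T * (1 / 2) ^ (n + 1) = 3 * T * (1 / 2) ^ n := by ring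
  rw [hr_add]
  gcongr
  · exact_mod_cast hA_card n
  · exact_mod_cast hA_card (n + 1)

end CompactInterval

section GaussianContinuity

variable {Ω : Type*} [MeasurableSpace Ω] {P : Measure Ω} [IsProbabilityMeasure P] {T : ℝ}
  {E : Type*} [NormedAddCommGroup E] [NormedSpace ℝ E] [CompleteSpace E] [MeasurableSpace E]
  [BorelSpace E] [SecondCountableTopology E]

theorem IsGaussianSpace.exists_continuous_modification {G : Submodule ℝ (Lp ℝ 2 P)}
    (hG : IsGaussianSpace G) (hG_closed : IsClosed (G : Set (Lp ℝ 2 P))) (hT : 0 < T)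
    {X : Icc (0 : ℝ) T → weakSubmodule E G} {K δ : ℝ≥0} (hX : HolderWith K δ X) (hδ : 0 < δ) :
    ∃ Y : Icc (0 : ℝ) T → Ω → E, (∀ t, StronglyMeasurable (Y t)) ∧
      (∀ t, Y t =ᵐ[P] (X t : Lp E 2 P)) ∧ ∀ ω, Continuous fun t => Y t ω := by
  -- The exponent `q` only has to satisfy `1 ≤ q` and `2 < q * δ`.
  let q : ℝ≥0 := 2 / δ + 1
  have : Fact (1 ≤ (q : ℝ≥0∞)) := ⟨mod_cast le_add_self⟩
  have hqδ : 2 < q * δ := by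
    rw [add_mul, div_mul_cancel₀ _ hδ.ne', one_mul]
    exact lt_add_of_pos_right 2 hδ
  obtain ⟨J, hJ⟩ := hG.exists_inclusion (E := E) hG_closed (q := q) ENNReal.coe_ne_top
  obtain ⟨Y, hY_meas, hY, hY_cont⟩ :=
    exists_continuous_modification_Icc hT (J.lipschitz.holderWith.comp hX) (by rwa [one_mul])
  exact ⟨Y, hY_meas, fun t => (hY t).trans (hJ (X t)), hY_cont⟩

end GaussianContinuity

section TruncationIncrements

variable {T : ℝ} {p q : ℝ≥0∞} {E : Type*} [NormedAddCommGroup E] {h : ℝ → E}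

theorem eLpNorm_indicator_Ioc_le (hpq : p ≤ q) (hh : AEStronglyMeasurable h (timeMeasure T))
    {δ : ℝ≥0} (hδ : (δ : ℝ) = 1 / p.toReal - 1 / q.toReal) (s t : ℝ) :
    eLpNorm ((Ioc s t).indicator h) p (timeMeasure T) ≤
      eLpNorm h q (timeMeasure T) * ENNReal.ofReal (t - s) ^ (δ : ℝ) := by
  rw [eLpNorm_indicator_eq_eLpNorm_restrict measurableSet_Ioc, hδ]
  refine (eLpNorm_le_eLpNorm_mul_rpow_measure_univ hpq hh.restrict).trans ?_
  have hmeasure : (timeMeasure T).restrict (Ioc s t) univ ≤ ENNReal.ofReal (t - s) := by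
    rw [Measure.restrict_apply_univ, ← Real.volume_Ioc]
    exact Measure.restrict_apply_le _ _
  gcongr
  · exact Measure.restrict_le_self
  · exact hδ ▸ δ.coe_nonneg

theorem indicator_Ioc_sub_indicator_Ioc {r s t : ℝ} (hrs : r ≤ s) (hst : s ≤ t) :
    (Ioc r t).indicator h - (Ioc r s).indicator h = (Ioc s t).indicator h := by
  rw [sub_eq_iff_eq_add', ← Ioc_union_Ioc_eq_Ioc hrs hst,
    indicator_union_of_disjoint (Ioc_disjoint_Ioc_of_le le_rfl)]
  rfl

theorem holderWith_truncLp [Fact (1 ≤ p)] (hpq : p ≤ q) (hh : MemLp h p (timeMeasure T))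
    (hhq : MemLp h q (timeMeasure T)) {δ : ℝ≥0} (hδ : (δ : ℝ) = 1 / p.toReal - 1 / q.toReal) :
    HolderWith (eLpNorm h q (timeMeasure T)).toNNReal δ
      fun t : Icc (0 : ℝ) T => truncLp hh t := by
  intro s t
  wlog hst : t ≤ s generalizing s t
  · rw [edist_comm, edist_comm s]
    exact this t s (le_of_not_ge hst)
  calc edist (truncLp hh s) (truncLp hh t)
      = eLpNorm ((Ioc (t : ℝ) s).indicator h) p (timeMeasure T) := by
        rw [truncLp, truncLp, Lp.edist_toLp_toLp, indicator_Ioc_sub_indicator_Ioc t.2.1 hst]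
    _ ≤ eLpNorm h q (timeMeasure T) * ENNReal.ofReal (s - t) ^ (δ : ℝ) :=
        eLpNorm_indicator_Ioc_le hpq hh.1 hδ _ _
    _ = (eLpNorm h q (timeMeasure T)).toNNReal * edist s t ^ (δ : ℝ) := by
        rw [ENNReal.coe_toNNReal hhq.2.ne, edist_dist, Subtype.dist_eq, Real.dist_eq,
          abs_of_nonneg (sub_nonneg.2 (show (t : ℝ) ≤ s from hst))]

end TruncationIncrements

section NoiseProcess

variable {Ω : Type*} [MeasurableSpace Ω] {P : Measure Ω} {T : ℝ} {φ : ℝ → ℝ → ℝ} {p : ℝ≥0∞}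
  [Fact (1 ≤ p)] [hp : Fact (p ≠ ∞)]
  {U : Type*} [NormedAddCommGroup U] [InnerProductSpace ℝ U]
  {H : Type*} [NormedAddCommGroup H] [InnerProductSpace ℝ H] [CompleteSpace H]
  [MeasurableSpace H] [BorelSpace H] [SecondCountableTopology H]
  {g : ℕ → Icc (0 : ℝ) T → Ω → ℝ} {e : HilbertBasis ℕ ℝ U} {lam : ℕ → ℝ} {h : ℝ → U →L[ℝ] H}

theorem isGaussianProcess_gaussianIntegral {G : Submodule ℝ (Lp ℝ 2 P)} (hG : IsGaussianSpace G)
    (hG_closed : IsClosed (G : Set (Lp ℝ 2 P))) (hφ : KernelCondition T φ p)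
    (hg : ∀ n, HasKernelCov P φ (g n)) (hgG : ∀ n t, ((hg n).memLp t).toLp ∈ G)
    (hlam : Summable fun n => √(lam n)) (hh : MemLp h p (timeMeasure T)) :
    IsGaussianProcess
      (fun (t : Icc (0 : ℝ) T) (ω : Ω) => gaussianIntegral P p g e lam h t ω) P := by
  simp only [gaussianIntegral_eq_noiseIntegralL g e lam hh hφ hg hlam]
  exact hG.isGaussianProcess fun t =>
    noiseIntegralL_mem_weakSubmodule hG_closed hφ hg hgG hlam (truncLp hh t)

theorem exists_continuous_gaussianIntegral [IsProbabilityMeasure P]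
    {G : Submodule ℝ (Lp ℝ 2 P)} (hG : IsGaussianSpace G)
    (hG_closed : IsClosed (G : Set (Lp ℝ 2 P))) (hT : 0 < T) (hφ : KernelCondition T φ p)
    (hg : ∀ n, HasKernelCov P φ (g n)) (hgG : ∀ n t, ((hg n).memLp t).toLp ∈ G)
    (hlam : Summable fun n => √(lam n)) {q : ℝ≥0∞} (hpq : p < q) (hq : q ≠ ∞)
    (hhq : MemLp h q (timeMeasure T)) :
    ∃ Y : Icc (0 : ℝ) T → Ω → H, (∀ t, StronglyMeasurable (Y t)) ∧
      (∀ t, Y t =ᵐ[P] gaussianIntegral P p g e lam h t) ∧ ∀ ω, Continuous fun t => Y t ω := by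
  have hh : MemLp h p (timeMeasure T) := hhq.mono_exponent hpq.le
  have hp_pos : 0 < p.toReal :=
    ENNReal.toReal_pos (zero_lt_one.trans_le (Fact.out : 1 ≤ p)).ne' hp.out
  have hpq_inv : 0 < 1 / p.toReal - 1 / q.toReal :=
    sub_pos.2 (one_div_lt_one_div_of_lt hp_pos ((ENNReal.toReal_lt_toReal hp.out hq).2 hpq))
  obtain ⟨δ, hδ⟩ : ∃ δ : ℝ≥0, (δ : ℝ) = 1 / p.toReal - 1 / q.toReal :=
    ⟨⟨_, hpq_inv.le⟩, rfl⟩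
  have hδ_pos : 0 < δ := NNReal.coe_pos.1 (hδ ▸ hpq_inv)
  let I := (noiseIntegralL P p g e lam).codRestrict (weakSubmodule H G) fun f =>
    noiseIntegralL_mem_weakSubmodule hG_closed hφ hg hgG hlam f
  simp only [gaussianIntegral_eq_noiseIntegralL g e lam hh hφ hg hlam]
  exact hG.exists_continuous_modification hG_closed hT
    (I.lipschitz.holderWith.comp (holderWith_truncLp hpq.le hh hhq hδ)) (by rwa [one_mul])

end NoiseProcess

end GaussianIntegral

end

open GaussianIntegral in
theorem proposition1_general
    {Ω : Type*} [MeasurableSpace Ω] (P : Measure Ω) [IsProbabilityMeasure P]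
    {U : Type*} [NormedAddCommGroup U] [InnerProductSpace ℝ U] [CompleteSpace U]
    {H : Type*} [NormedAddCommGroup H] [InnerProductSpace ℝ H] [CompleteSpace H]
    [TopologicalSpace.SeparableSpace H] [MeasurableSpace H] [BorelSpace H]
    (T : ℝ) (hT : 0 < T) (φ : ℝ → ℝ → ℝ)
    (p : ℝ≥0∞) [Fact (1 ≤ p)] (hp' : p < ∞) (hφ : KernelCondition T φ p)
    (g : ℕ → Icc (0 : ℝ) T → Ω → ℝ)
    (hg_gauss : ∀ n, IsGaussianProcess (g n) P)
    (hg_mean : ∀ n t, ∫ ω, g n t ω ∂P = 0)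
    (hg_cov : ∀ n t s, covariance (g n t) (g n s) P = kernelCov φ t s)
    (hg_indep : iIndepFun (fun n ω t => g n t ω) P)
    (e : HilbertBasis ℕ ℝ U) (lam : ℕ → ℝ) (hlam : ∀ n, 0 ≤ lam n)
    (hlam_sum : Summable fun n => √(lam n)) :
    (∀ n, (∃! I : Lp H p (timeMeasure T) →L[ℝ] Lp H 2 P, IsWienerIntegral P p (g n) I) ∧
      IsWienerIntegral P p (g n) (wienerIntegralL P p (g n) : Lp H p (timeMeasure T) →L[ℝ] _)) ∧
    (∀ h : ℝ → U →L[ℝ] H, MemLp h p (timeMeasure T) → ∀ t ∈ Icc 0 T,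
      Summable (gaussianTerm P p g e lam h t)) ∧
    (∀ h : ℝ → U →L[ℝ] H, MemLp h p (timeMeasure T) →
      IsGaussianProcess
        (fun (t : Icc (0 : ℝ) T) (ω : Ω) => gaussianIntegral P p g e lam h t ω) P) ∧
    (∀ (ε : ℝ≥0) (h : ℝ → U →L[ℝ] H), 0 < ε → MemLp h (p + ε) (timeMeasure T) →
      ∃ Y : Icc (0 : ℝ) T → Ω → H, (∀ t, StronglyMeasurable (Y t)) ∧
        (∀ t, Y t =ᵐ[P] gaussianIntegral P p g e lam h t) ∧
        ∀ ω, Continuous fun t => Y t ω) ∧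
    (∀ h₁ h₂ : ℝ → U →L[ℝ] H, MemLp h₁ p (timeMeasure T) → MemLp h₂ p (timeMeasure T) →
      (∀ x y : H,
        Integrable (fun z : ℝ × ℝ =>
            ⟪(h₂ z.2 ∘L covOp e lam ∘L (h₁ z.1)†) x, y⟫ * φ z.1 z.2)
          ((timeMeasure T).prod (timeMeasure T)) ∧
        ∫ ω, ⟪gaussianIntegral P p g e lam h₁ T ω, x⟫ *
            ⟪gaussianIntegral P p g e lam h₂ T ω, y⟫ ∂P =
          ∫ s' in (0 : ℝ)..T, ∫ s in (0 : ℝ)..T,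
            ⟪(h₂ s' ∘L covOp e lam ∘L (h₁ s)†) x, y⟫ * φ s s') ∧
      (∀ s s' : ℝ, IsTraceClass (h₂ s' ∘L covOp e lam ∘L (h₁ s)†)) ∧
      ∀ (ι : Type*) (b : HilbertBasis ι ℝ H),
        Integrable (fun z : ℝ × ℝ =>
            trace b (h₂ z.2 ∘L covOp e lam ∘L (h₁ z.1)†) * φ z.1 z.2)
          ((timeMeasure T).prod (timeMeasure T)) ∧
        ∫ ω, ⟪gaussianIntegral P p g e lam h₁ T ω, gaussianIntegral P p g e lam h₂ T ω⟫ ∂P =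
          ∫ s' in (0 : ℝ)..T, ∫ s in (0 : ℝ)..T,
            trace b (h₂ s' ∘L covOp e lam ∘L (h₁ s)†) * φ s s') := by
  have : Fact (p ≠ ∞) := ⟨hp'.ne⟩
  have := UniformSpace.secondCountable_of_separable H
  have hg2 : ∀ n t, MemLp (g n t) 2 P := fun n t =>
    ((hg_gauss n).hasGaussianLaw_eval t).memLp_two
  obtain ⟨G, hG, hG_closed, hgG⟩ := exists_isGaussianSpace hg_gauss hg_mean hg_indep hg2
  have hg := isOrthogonalNoise_of_gaussian hg_gauss hg_mean hg_cov hg_indep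
  have hlam_abs := summable_abs_of_summable_sqrt hlam hlam_sum
  exact ⟨fun n => ⟨existsUnique_isWienerIntegral hφ (hg.hasKernelCov n),
      isWienerIntegral_wienerIntegralL hφ (hg.hasKernelCov n)⟩,
    fun h hh t _ => (hasSum_gaussianTerm g e lam hh hφ hg.hasKernelCov hlam_sum t).summable,
    fun h hh => isGaussianProcess_gaussianIntegral hG hG_closed hφ hg.hasKernelCov hgG hlam_sum hh,
    fun ε h hε hh => exists_continuous_gaussianIntegral hG hG_closed hT hφ hg.hasKernelCov hgG
      hlam_sum (ENNReal.lt_add_right hp'.ne (ENNReal.coe_ne_zero.2 hε.ne'))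
      (ENNReal.add_ne_top.2 ⟨hp'.ne, ENNReal.coe_ne_top⟩) hh,
    fun h₁ h₂ hh₁ hh₂ => ⟨fun x y =>
      ⟨integrable_inner_comp_covOp_comp_adjoint hφ hlam_abs hh₁ hh₂ x y,
        integral_inner_mul_inner_gaussianIntegral hT.le hφ hg hlam hlam_sum hh₁ hh₂ x y⟩,
      fun s s' => isTraceClass_comp_covOp_comp_adjoint hlam_abs _ _,
      fun ι b => ⟨integrable_trace_comp_covOp_comp_adjoint hφ hlam_abs hh₁ hh₂ b,
        integral_inner_gaussianIntegral hT.le hφ hg hlam hlam_sum hh₁ hh₂ b⟩⟩⟩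

open GaussianIntegral in
theorem proposition1
    {Ω : Type*} [MeasurableSpace Ω] (P : Measure Ω) [IsProbabilityMeasure P]
    {U : Type*} [NormedAddCommGroup U] [InnerProductSpace ℝ U] [CompleteSpace U]
    {H : Type*} [NormedAddCommGroup H] [InnerProductSpace ℝ H] [CompleteSpace H]
    [TopologicalSpace.SeparableSpace H] [MeasurableSpace H] [BorelSpace H]
    (T : ℝ) (hT : 0 < T) (φ : ℝ → ℝ → ℝ)
    (p : ℝ≥0∞) [Fact (1 ≤ p)] (hp : 1 < p) (hp' : p < ∞) (hφ : KernelCondition T φ p)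
    -- `g 0, g 1, …` are independent centred Gaussian processes with covariance function `R`
    (g : ℕ → Icc (0 : ℝ) T → Ω → ℝ)
    (hg_meas : ∀ n t, Measurable (g n t))
    (hg_gauss : ∀ n, IsGaussianProcess (g n) P)
    (hg_mean : ∀ n t, ∫ ω, g n t ω ∂P = 0)
    (hg_cov : ∀ n t s, covariance (g n t) (g n s) P = kernelCov φ t s)
    (hg_indep : iIndepFun (fun n ω t => g n t ω) P)
    (e : HilbertBasis ℕ ℝ U) (lam : ℕ → ℝ) (hlam : ∀ n, 0 < lam n)
    (hlam_sum : Summable fun n => √(lam n)) :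
    -- the integrals with respect to `g n` are well defined, and so is the one for `G`
    (∀ n, (∃! I : Lp H p (timeMeasure T) →L[ℝ] Lp H 2 P, IsWienerIntegral P p (g n) I) ∧
      IsWienerIntegral P p (g n) (wienerIntegralL P p (g n) : Lp H p (timeMeasure T) →L[ℝ] _)) ∧
    (∀ h : ℝ → U →L[ℝ] H, MemLp h p (timeMeasure T) → ∀ t ∈ Icc 0 T,
      Summable (gaussianTerm P p g e lam h t)) ∧
    -- `∫_0^· h dG` is an `H`-valued Gaussian process
    (∀ h : ℝ → U →L[ℝ] H, MemLp h p (timeMeasure T) →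
      IsGaussianProcess
        (fun (t : Icc (0 : ℝ) T) (ω : Ω) => gaussianIntegral P p g e lam h t ω) P) ∧
    -- with continuous sample paths (after modification) if `h ∈ L^{p+ε}`
    (∀ (ε : ℝ≥0) (h : ℝ → U →L[ℝ] H), 0 < ε → MemLp h (p + ε) (timeMeasure T) →
      ∃ Y : Icc (0 : ℝ) T → Ω → H, (∀ t, StronglyMeasurable (Y t)) ∧
        (∀ t, Y t =ᵐ[P] gaussianIntegral P p g e lam h t) ∧
        ∀ ω, Continuous fun t => Y t ω) ∧
    -- the covariance formulas
    (∀ h₁ h₂ : ℝ → U →L[ℝ] H, MemLp h₁ p (timeMeasure T) → MemLp h₂ p (timeMeasure T) →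
      (∀ x y : H,
        Integrable (fun z : ℝ × ℝ =>
            ⟪(h₂ z.2 ∘L covOp e lam ∘L (h₁ z.1)†) x, y⟫ * φ z.1 z.2)
          ((timeMeasure T).prod (timeMeasure T)) ∧
        ∫ ω, ⟪gaussianIntegral P p g e lam h₁ T ω, x⟫ *
            ⟪gaussianIntegral P p g e lam h₂ T ω, y⟫ ∂P =
          ∫ s' in (0 : ℝ)..T, ∫ s in (0 : ℝ)..T,
            ⟪(h₂ s' ∘L covOp e lam ∘L (h₁ s)†) x, y⟫ * φ s s') ∧
      (∀ s s' : ℝ, IsTraceClass (h₂ s' ∘L covOp e lam ∘L (h₁ s)†)) ∧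
      ∀ (ι : Type*) (b : HilbertBasis ι ℝ H),
        Integrable (fun z : ℝ × ℝ =>
            trace b (h₂ z.2 ∘L covOp e lam ∘L (h₁ z.1)†) * φ z.1 z.2)
          ((timeMeasure T).prod (timeMeasure T)) ∧
        ∫ ω, ⟪gaussianIntegral P p g e lam h₁ T ω, gaussianIntegral P p g e lam h₂ T ω⟫ ∂P =
          ∫ s' in (0 : ℝ)..T, ∫ s in (0 : ℝ)..T,
            trace b (h₂ s' ∘L covOp e lam ∘L (h₁ s)†) * φ s s') := by
  exact proposition1_general P T hT φ p hp' hφ g hg_gauss hg_mean hg_cov hg_indep e lam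
    (fun n => (hlam n).le) hlam_sum
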